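/- **Setting.** Let $n\in\mathbb N$ and $S\subseteq\mathbb R^n$, and let $d=(d^{(1)},\dots,d^{(n)}):S\to\mathbb R^n$ be a sample from a multivariate Gaussian process with zero mean. The $j$-th coordinate has an isotropic covariance kernel, $\mathrm{Cov}(d^{(j)}(x),d^{(j)}(y))=\kappa_j(\|x-y\|)$ (for example the same kernel for all $j$). With constants $C_K,a_1,a_2>0$ and $\omega\in(0,1]$, assume for every $j$: * $\sqrt{2(\kappa_j(0)-\kappa_j(r))}\le C_K r^{\omega}$ for all $r>0$; * for every $L>0$, with probability at least $1-a_1 n e^{-L^2/a_2^2}$, at all interior points $x$ of $S$ all first partial derivatives of $d^{(j)}$ exist and satisfy $|\partial d^{(j)}(x)/\partial x^{(i)}|<L$, $i=1,\dots,n$. Let $B(o,\rho)\subseteq S$ be an open ball. The agent draws i.i.d. points $X_1,\dots,X_N$ in $B(o,\rho)$ from a sampling density $q$ with $q\ge\underline c>0$ on the ball, and observes $Y_i=d(X_i)+\varepsilon_i$, where $\varepsilon_1,\dots,\varepsilon_N$ are i.i.d. $\mathcal N(0,s^2I_n)$ with $s>0$; the field $d$, the points and the noise are mutually independent. The posterior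 mean $\mu_N=(\mu_N^{(1)},\dots,\mu_N^{(n)})$ is computed coordinatewise, $$\mu_N^{(j)}(x)=k_j(x)^{\top}(K_j+s^2I_N)^{-1}\big(Y_1^{(j)},\dots,Y_N^{(j)}\big)^{\top},$$ where $k_j(x)=(\kappa_j(\|x-X_i\|))_{i}$ and $K_j=(\kappa_j(\|X_i-X_l\|))_{i,l}$. **Theorem (sample complexity of GP estimation).** For all $n$ and $\omega\in(0,1]$ there is an exponent $p\in\mathbb N$, depending only on $n$ and $\omega$, such that for all $C_K,a_1,a_2,\rho,\psi_{\max}>0$ there is a constant $C>0$, depending only on $n,\omega,C_K,a_1,a_2,\rho,\psi_{\max}$, with the following property. In the setting above, for all $\psi\in(0,\psi_{\max}]$, $\delta\in(0,1)$, $\underline c>0$, $s>0$ and every $N$ with $$N\ \ge\ C\Big(1+\log\tfrac1\delta+\log\big(1+\tfrac1\psi\big)\Big)^{p}\,\max\Big\{\frac{2\sqrt n}{\psi},\ \frac{\psi^{-2n/\omega}}{\underline c^{2}},\ \frac{s^{2}\psi^{-(2\omega+n)/\omega}}{\underline c}\Big\},$$ with probability at least $1-\delta$, $$\|d(x)-\mu_N(x)\|_2\le\psi\qquad\text{for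 all }x\in B(o,\rho).$$ -/

import Mathlib

open MeasureTheory ProbabilityTheory
open scoped ENNReal

/-- Posterior mean at `x` of a real-valued, zero-mean Gaussian process with covariance kernel `k`,
given the observations `y i` at the points `z i`, with Gaussian noise of variance `s ^ 2`:
`k(x, z)ᵀ (K + s² I)⁻¹ y` with `K = (k(z i, z l))`. -/
noncomputable def gpPosteriorMean {E : Type*} {N : ℕ} (k : E → E → ℝ) (s : ℝ)
    (z : Fin N → E) (y : Fin N → ℝ) (x : E) : ℝ :=
  (fun i => k x (z i)) ⬝ᵥ
    Matrix.mulVec (Matrix.of (fun i l => k (z i) (z l)) + s ^ 2 • (1 : Matrix (Fin N) (Fin N) ℝ))⁻¹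
      y

/-- Posterior mean of the vector field, computed coordinate by coordinate: the `j`-th coordinate
has the isotropic kernel `(x, y) ↦ κ j ‖x - y‖` and uses the `j`-th coordinates of the data. -/
noncomputable def vectorPosteriorMean {n N : ℕ} (κ : Fin n → ℝ → ℝ) (s : ℝ)
    (z : Fin N → EuclideanSpace ℝ (Fin n)) (y : Fin N → EuclideanSpace ℝ (Fin n))
    (x : EuclideanSpace ℝ (Fin n)) : EuclideanSpace ℝ (Fin n) :=
  WithLp.toLp 2 fun j => gpPosteriorMean (fun u v => κ j ‖u - v‖) s z (fun i => y i j) x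

/-- `d` is a random vector field on the state space `S ⊆ ℝⁿ`: a multivariate Gaussian process with
zero mean, whose `j`-th coordinate has the isotropic covariance kernel `κ j ‖x - y‖`, with kernel
modulus constants `CK`, `ω` and sub-Gaussian tails (constants `a₁`, `a₂`) for the suprema of the
first partial derivatives of the sample paths.
Values of `d` outside `S` play no role. -/
structure IsGPDisturbance {Ω : Type*} [MeasurableSpace Ω] (P : Measure Ω) {n : ℕ}
    (S : Set (EuclideanSpace ℝ (Fin n))) (κ : Fin n → ℝ → ℝ) (CK ω a₁ a₂ : ℝ)
    (d : EuclideanSpace ℝ (Fin n) → Ω → EuclideanSpace ℝ (Fin n)) : Prop where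
  measurable : ∀ x ∈ S, Measurable (d x)
  gaussian : IsGaussianProcess (fun x : S => d x) P
  mean_zero : ∀ x ∈ S, ∀ j, ∫ w, d x w j ∂P = 0
  covariance_eq : ∀ x ∈ S, ∀ y ∈ S, ∀ j,
    covariance (fun w => d x w j) (fun w => d y w j) P = κ j ‖x - y‖
  kernel_modulus : ∀ j, ∀ r : ℝ, 0 < r → √(2 * (κ j 0 - κ j r)) ≤ CK * r ^ ω
  /-- For each `j` and each level `L > 0`, with probability at least
  `1 - a₁ n exp (-L² / a₂²)` all partial derivatives of the `j`-th coordinate exist and are less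
  than `L` in absolute value (the bound is put on the measure of the complement). -/
  derivative_tail : ∀ j, ∀ L : ℝ, 0 < L →
    P {w | ¬ ∀ x ∈ interior S, ∀ i : Fin n, ∃ D : ℝ,
        HasLineDerivAt ℝ (fun y => d y w j) D x (EuclideanSpace.single i 1) ∧ |D| < L}
      ≤ ENNReal.ofReal (a₁ * n * Real.exp (-(L ^ 2 / a₂ ^ 2)))

/-- `z 0, …, z (N-1)` are i.i.d. points of the ball `B(o, ρ)` whose common law has a density `q`
with respect to Lebesgue measure, bounded below by `c` on the ball; `ε 0, …, ε (N-1)` are i.i.d.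
Gaussian vectors with mean zero and covariance `s² I`; the field `d` (on `S`), the points and the
noise vectors are independent. -/
structure IsNoisySampling {Ω : Type*} [MeasurableSpace Ω] (P : Measure Ω) {n N : ℕ}
    (S : Set (EuclideanSpace ℝ (Fin n)))
    (d : EuclideanSpace ℝ (Fin n) → Ω → EuclideanSpace ℝ (Fin n))
    (o : EuclideanSpace ℝ (Fin n)) (ρ c s : ℝ) (q : EuclideanSpace ℝ (Fin n) → ℝ)
    (z ε : Fin N → Ω → EuclideanSpace ℝ (Fin n)) : Prop where
  density_measurable : Measurable q
  density_lower : ∀ x ∈ Metric.ball o ρ, c ≤ q x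
  points_measurable : ∀ i, Measurable (z i)
  points_law : ∀ i, HasLaw (z i)
    ((volume.restrict (Metric.ball o ρ)).withDensity fun x => ENNReal.ofReal (q x)) P
  points_indep : iIndepFun z P
  noise_measurable : ∀ i, Measurable (ε i)
  noise_law : ∀ i, HasLaw (ε i)
    (multivariateGaussian 0 (s ^ 2 • (1 : Matrix (Fin n) (Fin n) ℝ))) P
  noise_indep : iIndepFun ε P
  points_noise_indep : IndepFun (fun w i => z i w) (fun w i => ε i w) P
  field_data_indep :
    IndepFun (fun w (x : S) => d x w) (fun w => ((fun i => z i w), (fun i => ε i w))) P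

/-! ### Fixed design: posterior variance via best linear prediction. -/

section GaussianRegression

variable {Ω T : Type*} [MeasurableSpace Ω] {P : Measure Ω} {N : ℕ}

/-! For a fixed design the posterior mean is the best linear predictor, so its error variance at a
point is at most that of the plain average of the observations made within distance `r`. This is a
kernel term `CK ^ 2 * r ^ (2 * ω)` plus the noise variance divided by the number of such
observations (`variance_posteriorResidual_le_of_close`). Gaussian tails and a union bound then
control the error on a finite net of the ball.

Passing from the net to the whole ball needs a Lipschitz bound for the residual `R = f - M`, where
`M` is the posterior mean, while the assumptions only control the paths of `f`. Symmetry supplies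
it: `M` and `R` are centered, uncorrelated and jointly Gaussian, so the reflected field `M - R = f -
2 R` has the same law as `f = M + R` (`map_reflection`). With high probability both are Lipschitz,
hence so is `R`, which is half their difference. This gives `measure_exists_posteriorResidual_gt_le`
at the price of counting the derivative tail twice.

The true design is random, but independent of field and noise. For continuous paths the error event
is open in the design, so the bound for frozen designs carries over along finite-valued
approximations (`measure_le_of_eventually_mem`). Hoeffding's inequality puts more than `N p / 2`
sample points near each net point, where `p` bounds the hitting probability from below.

With `Λ` the logarithmic factor, the radius is chosen of order `(ψ / √Λ) ^ (1 / ω)`. The posterior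
variance is then of order `ψ ^ 2 / Λ` and all failure probabilities decay exponentially in `Λ`, with
rates large enough to beat the covering number. -/

/-- Joint Gaussian model for the values `f x` of a scalar centered field with covariance kernel `k`
and centered uncorrelated noise variables `e i` of variance `s ^ 2`. -/
structure IsGaussianRegression (P : Measure Ω) (f : T → Ω → ℝ) (e : Fin N → Ω → ℝ)
    (k : T → T → ℝ) (s : ℝ) : Prop where
  measurable_field : ∀ x, Measurable (f x)
  measurable_noise : ∀ i, Measurable (e i)
  gaussian : IsGaussianProcess (Sum.elim f e) P
  mean_field : ∀ x, P[f x] = 0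
  mean_noise : ∀ i, P[e i] = 0
  cov_field : ∀ x y, cov[f x, f y; P] = k x y
  cov_field_noise : ∀ x i, cov[f x, e i; P] = 0
  cov_noise : ∀ i l, cov[e i, e l; P] = if i = l then s ^ 2 else 0

/-- The Gram matrix of the design `v` regularized by the noise variance. -/
noncomputable def noisyGram (k : T → T → ℝ) (s : ℝ) (v : Fin N → T) : Matrix (Fin N) (Fin N) ℝ :=
  Matrix.of (fun i l => k (v i) (v l)) + s ^ 2 • (1 : Matrix (Fin N) (Fin N) ℝ)

/-- The weights of the observations in the posterior mean at `x`. -/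
noncomputable def posteriorWeight (k : T → T → ℝ) (s : ℝ) (v : Fin N → T) (x : T) : Fin N → ℝ :=
  Matrix.vecMul (fun i => k x (v i)) (noisyGram k s v)⁻¹

lemma gpPosteriorMean_eq_sum (k : T → T → ℝ) (s : ℝ) (v : Fin N → T) (y : Fin N → ℝ) (x : T) :
    gpPosteriorMean k s v y x = ∑ i, posteriorWeight k s v x i * y i := by
  rw [gpPosteriorMean, Matrix.dotProduct_mulVec]
  rfl

namespace IsGaussianRegression

variable {f : T → Ω → ℝ} {e : Fin N → Ω → ℝ} {k : T → T → ℝ} {s : ℝ}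

lemma isProbabilityMeasure (h : IsGaussianRegression P f e k s) : IsProbabilityMeasure P :=
  h.gaussian.isProbabilityMeasure

lemma memLp_field (h : IsGaussianRegression P f e k s) (x : T) : MemLp (f x) 2 P :=
  (h.gaussian.hasGaussianLaw_eval (Sum.inl x)).memLp_two

lemma memLp_noise (h : IsGaussianRegression P f e k s) (i : Fin N) : MemLp (e i) 2 P :=
  (h.gaussian.hasGaussianLaw_eval (Sum.inr i)).memLp_two

/-- The quadratic form of the kernel matrix at `c` is the variance of `∑ i, c i * f (v i)`; the
noise term makes it strictly positive. -/
lemma posDef_noisyGram (h : IsGaussianRegression P f e k s) (hs : 0 < s) (v : Fin N → T) :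
    (noisyGram k s v).PosDef := by
  have := h.isProbabilityMeasure
  have h1 : (Matrix.of (fun i l => k (v i) (v l))).PosSemidef := by
    refine Matrix.PosSemidef.of_dotProduct_mulVec_nonneg ?_ fun c => ?_
    · ext i l
      simp [← h.cov_field, covariance_comm]
    · have := variance_nonneg (fun w => ∑ i, c i * f (v i) w) P
      have hm : ∀ i, MemLp (fun w => c i * f (v i) w) 2 P := fun i =>
        (h.memLp_field _).const_mul _
      rw [← covariance_self (memLp_finsetSum _ fun i _ => hm i).aemeasurable,
        covariance_fun_sum_fun_sum hm hm] at this
      simp only [covariance_const_mul_left, covariance_const_mul_right, h.cov_field] at this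
      simpa [dotProduct, Matrix.mulVec, Finset.mul_sum, mul_assoc, mul_comm, mul_left_comm]
        using this
  exact Matrix.PosDef.posSemidef_add h1 (Matrix.PosDef.one.smul (pow_pos hs 2))

/-- These are the normal equations of linear prediction; they are what makes the residual orthogonal
to the data. -/
lemma sum_posteriorWeight_mul (h : IsGaussianRegression P f e k s) (hs : 0 < s) (v : Fin N → T)
    (x : T) (l : Fin N) :
    ∑ i, posteriorWeight k s v x i * (k (v i) (v l) + if i = l then s ^ 2 else 0) = k x (v l) := by
  have hu : IsUnit (noisyGram k s v).det := (h.posDef_noisyGram hs v).det_pos.ne'.isUnit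
  have h1 : Matrix.vecMul (posteriorWeight k s v x) (noisyGram k s v) = fun i => k x (v i) := by
    rw [posteriorWeight, Matrix.vecMul_vecMul, Matrix.nonsing_inv_mul _ hu, Matrix.vecMul_one]
  rw [← congrFun h1 l]
  simp [Matrix.vecMul, dotProduct, noisyGram, Matrix.one_apply]

/-- The observation at the `i`-th design point. -/
def noisyObs (f : T → Ω → ℝ) (e : Fin N → Ω → ℝ) (v : Fin N → T) (i : Fin N) (w : Ω) : ℝ :=
  f (v i) w + e i w

/-- The posterior mean at `x` for the fixed design `v`, as a random variable. -/
noncomputable def posteriorMeanField (f : T → Ω → ℝ) (e : Fin N → Ω → ℝ) (k : T → T → ℝ) (s : ℝ)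
    (v : Fin N → T) (x : T) (w : Ω) : ℝ :=
  gpPosteriorMean k s v (fun i => noisyObs f e v i w) x

omit [MeasurableSpace Ω] in
lemma posteriorMeanField_eq_sum (f : T → Ω → ℝ) (e : Fin N → Ω → ℝ) (v : Fin N → T) (x : T) :
    posteriorMeanField f e k s v x =
      fun w => ∑ i, posteriorWeight k s v x i * noisyObs f e v i w :=
  funext fun _ => gpPosteriorMean_eq_sum _ _ _ _ _

/-- Field minus posterior mean for the fixed design `v`. -/
noncomputable def posteriorResidual (f : T → Ω → ℝ) (e : Fin N → Ω → ℝ) (k : T → T → ℝ) (s : ℝ)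
    (v : Fin N → T) (x : T) (w : Ω) : ℝ :=
  f x w - posteriorMeanField f e k s v x w

lemma memLp_noisyObs (h : IsGaussianRegression P f e k s) (v : Fin N → T) (i : Fin N) :
    MemLp (noisyObs f e v i) 2 P :=
  (h.memLp_field _).add (h.memLp_noise i)

lemma memLp_sum_noisyObs (h : IsGaussianRegression P f e k s) (v : Fin N → T) (c : Fin N → ℝ) :
    MemLp (fun w => ∑ i, c i * noisyObs f e v i w) 2 P :=
  memLp_finsetSum _ fun i _ => (h.memLp_noisyObs v i).const_mul _

lemma memLp_posteriorMeanField (h : IsGaussianRegression P f e k s) (v : Fin N → T) (x : T) :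
    MemLp (posteriorMeanField f e k s v x) 2 P := by
  rw [posteriorMeanField_eq_sum]
  exact h.memLp_sum_noisyObs v _

lemma memLp_posteriorResidual (h : IsGaussianRegression P f e k s) (v : Fin N → T) (x : T) :
    MemLp (posteriorResidual f e k s v x) 2 P :=
  (h.memLp_field x).sub (h.memLp_posteriorMeanField v x)

lemma cov_field_noisyObs (h : IsGaussianRegression P f e k s) (v : Fin N → T) (x : T) (l : Fin N) :
    cov[f x, noisyObs f e v l; P] = k x (v l) := by
  have := h.isProbabilityMeasure
  change cov[f x, f (v l) + e l; P] = _
  rw [covariance_add_right (h.memLp_field _) (h.memLp_field _) (h.memLp_noise _),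
    h.cov_field, h.cov_field_noise, add_zero]

lemma cov_noisyObs (h : IsGaussianRegression P f e k s) (v : Fin N → T) (i l : Fin N) :
    cov[noisyObs f e v i, noisyObs f e v l; P] = k (v i) (v l) + if i = l then s ^ 2 else 0 := by
  have := h.isProbabilityMeasure
  change cov[f (v i) + e i, noisyObs f e v l; P] = _
  rw [covariance_add_left (h.memLp_field _) (h.memLp_noise _) (h.memLp_noisyObs v l),
    h.cov_field_noisyObs]
  change _ + cov[e i, f (v l) + e l; P] = _
  rw [covariance_add_right (h.memLp_noise _) (h.memLp_field _) (h.memLp_noise _),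
    covariance_comm, h.cov_field_noise, h.cov_noise, zero_add]

lemma cov_posteriorResidual_noisyObs (h : IsGaussianRegression P f e k s) (hs : 0 < s)
    (v : Fin N → T) (x : T) (l : Fin N) :
    cov[posteriorResidual f e k s v x, noisyObs f e v l; P] = 0 := by
  have := h.isProbabilityMeasure
  change cov[fun w => f x w - posteriorMeanField f e k s v x w, noisyObs f e v l; P] = 0
  rw [covariance_fun_sub_left (h.memLp_field x) (h.memLp_posteriorMeanField v x)
    (h.memLp_noisyObs v l), h.cov_field_noisyObs, posteriorMeanField_eq_sum,
    covariance_fun_sum_left (fun i => (h.memLp_noisyObs v i).const_mul _) (h.memLp_noisyObs v l)]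
  simp only [covariance_const_mul_left, h.cov_noisyObs]
  rw [h.sum_posteriorWeight_mul hs, sub_self]

lemma cov_posteriorResidual_sum_noisyObs (h : IsGaussianRegression P f e k s) (hs : 0 < s)
    (v : Fin N → T) (x : T) (c : Fin N → ℝ) :
    cov[posteriorResidual f e k s v x, fun w => ∑ i, c i * noisyObs f e v i w; P] = 0 := by
  have := h.isProbabilityMeasure
  rw [covariance_fun_sum_right (fun i => (h.memLp_noisyObs v i).const_mul _)
    (h.memLp_posteriorResidual v x)]
  simp only [covariance_const_mul_right, h.cov_posteriorResidual_noisyObs hs, mul_zero,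
    Finset.sum_const_zero]

/-- The posterior mean is the best linear predictor. -/
lemma variance_posteriorResidual_le (h : IsGaussianRegression P f e k s) (hs : 0 < s)
    (v : Fin N → T) (x : T) (c : Fin N → ℝ) :
    Var[posteriorResidual f e k s v x; P] ≤
      Var[fun w => f x w - ∑ i, c i * noisyObs f e v i w; P] := by
  have := h.isProbabilityMeasure
  -- Pythagoras: any other predictor differs from the posterior mean by a combination of
  -- observations, which is uncorrelated with the residual.
  have h1 : (fun w => f x w - ∑ i, c i * noisyObs f e v i w) =
      fun w => posteriorResidual f e k s v x w +
        ∑ i, (posteriorWeight k s v x i - c i) * noisyObs f e v i w := by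
    funext w
    simp only [posteriorResidual, posteriorMeanField_eq_sum, sub_mul, Finset.sum_sub_distrib]
    ring
  rw [h1, variance_fun_add (h.memLp_posteriorResidual v x) (h.memLp_sum_noisyObs v _),
    h.cov_posteriorResidual_sum_noisyObs hs]
  linarith [variance_nonneg (fun w => ∑ i, (posteriorWeight k s v x i - c i) *
    noisyObs f e v i w) P]

end IsGaussianRegression

/-- Expand `0 ≤ Var[X - Y]`. -/
lemma ProbabilityTheory.covariance_le_of_variance_le [IsProbabilityMeasure P] {X Y : Ω → ℝ} {b : ℝ}
    (hX : MemLp X 2 P) (hY : MemLp Y 2 P) (hXb : Var[X; P] ≤ b) (hYb : Var[Y; P] ≤ b) :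
    cov[X, Y; P] ≤ b := by
  have h1 := variance_fun_sub hX hY
  have h2 := variance_nonneg (fun w => X w - Y w) P
  linarith

/-- The variance of an average is at most the largest variance. -/
lemma ProbabilityTheory.variance_average_le [IsProbabilityMeasure P] {ι : Type*} {I : Finset ι}
    (hI : I.Nonempty) {g : ι → Ω → ℝ} {b : ℝ} (hg : ∀ i ∈ I, MemLp (g i) 2 P)
    (hb : ∀ i ∈ I, Var[g i; P] ≤ b) :
    Var[fun w => (I.card : ℝ)⁻¹ * ∑ i ∈ I, g i w; P] ≤ b := by
  have hc : (0 : ℝ) < I.card := by exact_mod_cast hI.card_pos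
  rw [variance_const_mul, ← covariance_self (memLp_finsetSum _ hg).aemeasurable,
    covariance_fun_sum_fun_sum' hg hg]
  have h1 : ∑ i ∈ I, ∑ j ∈ I, cov[g i, g j; P] ≤ ∑ i ∈ I, ∑ j ∈ I, b :=
    Finset.sum_le_sum fun i hi => Finset.sum_le_sum fun j hj =>
      covariance_le_of_variance_le (hg i hi) (hg j hj) (hb i hi) (hb j hj)
  calc (I.card : ℝ)⁻¹ ^ 2 * ∑ i ∈ I, ∑ j ∈ I, cov[g i, g j; P]
      ≤ (I.card : ℝ)⁻¹ ^ 2 * ∑ i ∈ I, ∑ j ∈ I, b := by gcongr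
    _ = b := by simp only [Finset.sum_const, nsmul_eq_mul]; field_simp

namespace IsGaussianRegression

variable {f : T → Ω → ℝ} {e : Fin N → Ω → ℝ} {k : T → T → ℝ} {s : ℝ}

/-- If many design points are close to `x`, the posterior variance at `x` is small. -/
lemma variance_posteriorResidual_le_of_close (h : IsGaussianRegression P f e k s) (hs : 0 < s)
    (v : Fin N → T) (x : T) {I : Finset (Fin N)} (hI : I.Nonempty) {b : ℝ}
    (hb : ∀ i ∈ I, k x x + k (v i) (v i) - 2 * k x (v i) ≤ b) :
    Var[posteriorResidual f e k s v x; P] ≤ b + s ^ 2 / I.card := by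
  have := h.isProbabilityMeasure
  have hc : (0 : ℝ) < I.card := by exact_mod_cast hI.card_pos
  -- Compare with uniform weights on `I`. The error is then an average `U` of field increments minus
  -- an average `V` of noise. Only `V` gains from averaging, since the increments may be strongly
  -- correlated.
  refine (h.variance_posteriorResidual_le hs v x
    fun i => if i ∈ I then (I.card : ℝ)⁻¹ else 0).trans ?_
  set U : Ω → ℝ := fun w => (I.card : ℝ)⁻¹ * ∑ i ∈ I, (f x w - f (v i) w) with hU
  set V : Ω → ℝ := fun w => (I.card : ℝ)⁻¹ * ∑ i ∈ I, e i w with hV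
  have hd : ∀ i, MemLp (fun w => f x w - f (v i) w) 2 P := fun i =>
    (h.memLp_field x).sub (h.memLp_field (v i))
  have hmU : MemLp U 2 P := (memLp_finsetSum _ fun i _ => hd i).const_mul _
  have hmV : MemLp V 2 P := (memLp_finsetSum _ fun i _ => h.memLp_noise i).const_mul _
  have h1 : (fun w => f x w - ∑ i, (if i ∈ I then (I.card : ℝ)⁻¹ else 0) * noisyObs f e v i w) =
      fun w => U w - V w := by
    funext w
    simp only [hU, hV, noisyObs, ite_mul, zero_mul, Finset.sum_ite_mem, Finset.univ_inter,
      ← Finset.mul_sum, Finset.sum_add_distrib, Finset.sum_sub_distrib, Finset.sum_const,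
      nsmul_eq_mul]
    field_simp
    ring
  have hUV : cov[U, V; P] = 0 := by
    rw [hU, hV, covariance_const_mul_left, covariance_const_mul_right,
      covariance_fun_sum_fun_sum' (fun i _ => hd i) (fun i _ => h.memLp_noise i)]
    simp [covariance_fun_sub_left (h.memLp_field _) (h.memLp_field _) (h.memLp_noise _),
      h.cov_field_noise]
  have hVarU : Var[U; P] ≤ b := by
    refine variance_average_le hI (fun i _ => hd i) fun i hi => ?_
    refine le_of_eq_of_le ?_ (hb i hi)
    rw [variance_fun_sub (h.memLp_field _) (h.memLp_field _), h.cov_field,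
      ← covariance_self (h.memLp_field _).aemeasurable,
      ← covariance_self (h.memLp_field _).aemeasurable, h.cov_field, h.cov_field]
    ring
  have hVarV : Var[V; P] = s ^ 2 / I.card := by
    rw [hV, variance_const_mul, ← covariance_self
      (memLp_finsetSum _ fun i _ => h.memLp_noise i).aemeasurable,
      covariance_fun_sum_fun_sum' (fun i _ => h.memLp_noise i) (fun i _ => h.memLp_noise i)]
    simp [h.cov_noise]
    field_simp
  rw [h1, variance_fun_sub hmU hmV, hUV, hVarV]
  linarith

end IsGaussianRegression
end GaussianRegression

/-! ### Reflection at the posterior mean and the uniform bound for a fixed design. -/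

section ReflectionPrinciple

variable {Ω T : Type*} [MeasurableSpace Ω] {P : Measure Ω} {N : ℕ}

/-- Finite linear combinations of a Gaussian process form a Gaussian process. -/
lemma ProbabilityTheory.IsGaussianProcess.linearCombination {S U : Type*} {X : U → Ω → ℝ}
    (hX : IsGaussianProcess X P) (c : S → U →₀ ℝ) :
    IsGaussianProcess (fun t w => Finsupp.linearCombination ℝ (fun u => X u w) (c t)) P := by
  refine hX.of_isGaussianProcess fun t => ⟨(c t).support,
    ∑ u : (c t).support, c t u • ContinuousLinearMap.proj u, fun w => ?_⟩
  rw [Finsupp.linearCombination_apply, Finsupp.sum, ← Finset.sum_coe_sort]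
  simp

/-- If `M` and `R` are uncorrelated centered processes such that `M + R` and `M - R` are Gaussian,
then `M + R` and `M - R` have the same law. -/
lemma ProbabilityTheory.map_add_eq_map_sub_of_uncorrelated {M R : T → Ω → ℝ}
    (hM : ∀ x, MemLp (M x) 2 P) (hR : ∀ x, MemLp (R x) 2 P)
    (hMm : ∀ x, Measurable (M x)) (hRm : ∀ x, Measurable (R x))
    (hM0 : ∀ x, P[M x] = 0) (hR0 : ∀ x, P[R x] = 0)
    (hMR : ∀ x y, cov[M x, R y; P] = 0)
    (hadd : IsGaussianProcess (fun x w => M x w + R x w) P)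
    (hsub : IsGaussianProcess (fun x w => M x w - R x w) P) :
    P.map (fun w x => M x w + R x w) = P.map (fun w x => M x w - R x w) := by
  classical
  have := hadd.isProbabilityMeasure
  rw [map_eq_iff_forall_finset_map_restrict_eq (X := fun x w => M x w + R x w)
    (Y := fun x w => M x w - R x w)
    (measurable_pi_lambda _ fun x => (hMm x).add (hRm x)).aemeasurable
    (measurable_pi_lambda _ fun x => (hMm x).sub (hRm x)).aemeasurable]
  intro I
  have h1 := hadd.hasGaussianLaw I
  have h2 := hsub.hasGaussianLaw I
  have i1 := h1.isGaussian_map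
  have i2 := h2.isGaussian_map
  -- A Gaussian law is determined by mean and variance of its linear functionals. On `M ± R` these
  -- are `A ± B`, with zero means and, as `A` and `B` are uncorrelated, equal variances.
  refine Measure.ext_of_charFunDual (funext fun L => ?_)
  rw [h1.charFunDual_map_eq_fun, h2.charFunDual_map_eq_fun]
  have hL : ∀ y : I → ℝ, L y = ∑ i, L (Pi.single i 1) * y i := fun y => by
    conv_lhs => rw [← Finset.univ_sum_single y]
    rw [map_sum]
    refine Finset.sum_congr rfl fun i _ => ?_
    rw [show Pi.single i (y i) = y i • (Pi.single i 1 : I → ℝ) by simp [← Pi.single_smul],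
      map_smul, smul_eq_mul, mul_comm]
  set a : I → ℝ := fun i => L (Pi.single i 1)
  set A : Ω → ℝ := fun w => ∑ i, a i * M i w with hA
  set B : Ω → ℝ := fun w => ∑ i, a i * R i w with hB
  have hAm : MemLp A 2 P := memLp_finsetSum _ fun i _ => (hM i).const_mul _
  have hBm : MemLp B 2 P := memLp_finsetSum _ fun i _ => (hR i).const_mul _
  have hAB : cov[A, B; P] = 0 := by
    rw [hA, hB, covariance_fun_sum_fun_sum (fun i : I => (hM i).const_mul _)
      (fun i : I => (hR i).const_mul _)]
    simp [covariance_const_mul_left, covariance_const_mul_right, hMR]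
  have hA0 : ∫ w, A w ∂P = 0 := by
    simp only [hA]
    rw [integral_finsetSum _ fun (i : I) _ => ((hM i).integrable (by norm_num)).const_mul _]
    simp [integral_const_mul, hM0]
  have hB0 : ∫ w, B w ∂P = 0 := by
    simp only [hB]
    rw [integral_finsetSum _ fun (i : I) _ => ((hR i).integrable (by norm_num)).const_mul _]
    simp [integral_const_mul, hR0]
  have e1 : (fun w => L (I.restrict fun x => M x w + R x w)) = fun w => A w + B w := by
    funext w
    rw [hL]
    simp [hA, hB, mul_add, Finset.sum_add_distrib, a]
  have e2 : (fun w => L (I.restrict fun x => M x w - R x w)) = fun w => A w - B w := by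
    funext w
    rw [hL]
    simp [hA, hB, mul_sub, Finset.sum_sub_distrib, a]
  have e1' : ∫ w, L (I.restrict fun x => M x w + R x w) ∂P = 0 := by
    rw [e1, integral_add (hAm.integrable (by norm_num)) (hBm.integrable (by norm_num)), hA0, hB0,
      add_zero]
  have e2' : ∫ w, L (I.restrict fun x => M x w - R x w) ∂P = 0 := by
    rw [e2, integral_sub (hAm.integrable (by norm_num)) (hBm.integrable (by norm_num)), hA0, hB0,
      sub_zero]
  rw [e1', e2', e1, e2,
    variance_fun_add hAm hBm, variance_fun_sub hAm hBm, hAB]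
  simp

/-- Two-sided Gaussian tail bound. -/
lemma ProbabilityTheory.HasGaussianLaw.measure_abs_ge_le {X : Ω → ℝ} (hX : HasGaussianLaw X P)
    (h0 : P[X] = 0) {v u : ℝ} (hv : Var[X; P] ≤ v) (hu : 0 ≤ u) :
    P {w | u ≤ |X w|} ≤ ENNReal.ofReal (2 * Real.exp (-u ^ 2 / (2 * v))) := by
  have := hX.isProbabilityMeasure
  have hv0 : 0 ≤ v := (variance_nonneg X P).trans hv
  have hs : HasSubgaussianMGF X v.toNNReal P := by
    constructor
    · intro t
      have := (integrable_exp_mul_gaussianReal (μ := P[X]) (v := Var[X; P].toNNReal) t)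
      rw [← hX.map_eq_gaussianReal] at this
      exact this.comp_aemeasurable hX.aemeasurable
    · intro t
      rw [mgf_gaussianReal hX.map_eq_gaussianReal, h0, zero_mul, zero_add]
      have : Var[X; P].toNNReal ≤ v.toNNReal := Real.toNNReal_le_toNNReal hv
      gcongr
  have h1 := hs.measure_ge_le hu
  have h2 := hs.neg.measure_ge_le hu
  rw [Real.coe_toNNReal _ hv0] at h1 h2
  have hsub : {w | u ≤ |X w|} ⊆ {w | u ≤ X w} ∪ {w | u ≤ (-X) w} := fun w hw => by
    simpa [le_abs] using hw
  rw [← ofReal_measureReal]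
  refine ENNReal.ofReal_le_ofReal ?_
  calc P.real {w | u ≤ |X w|} ≤ P.real ({w | u ≤ X w} ∪ {w | u ≤ (-X) w}) :=
        measureReal_mono hsub
    _ ≤ P.real {w | u ≤ X w} + P.real {w | u ≤ (-X) w} := measureReal_union_le _ _
    _ ≤ _ := by linarith

namespace IsGaussianRegression

variable {f : T → Ω → ℝ} {e : Fin N → Ω → ℝ} {k : T → T → ℝ} {s : ℝ}

lemma measurable_posteriorMeanField (h : IsGaussianRegression P f e k s) (v : Fin N → T) (x : T) :
    Measurable (posteriorMeanField f e k s v x) := by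
  rw [posteriorMeanField_eq_sum]
  exact Finset.measurable_fun_sum _ fun i _ =>
    ((h.measurable_field _).add (h.measurable_noise i)).const_mul _

lemma measurable_posteriorResidual (h : IsGaussianRegression P f e k s) (v : Fin N → T) (x : T) :
    Measurable (posteriorResidual f e k s v x) :=
  (h.measurable_field x).sub (h.measurable_posteriorMeanField v x)

lemma integral_posteriorMeanField (h : IsGaussianRegression P f e k s) (v : Fin N → T) (x : T) :
    P[posteriorMeanField f e k s v x] = 0 := by
  have := h.isProbabilityMeasure
  rw [posteriorMeanField_eq_sum, integral_finsetSum _ fun i _ =>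
    ((h.memLp_noisyObs v i).integrable (by norm_num)).const_mul _]
  refine Finset.sum_eq_zero fun i _ => ?_
  rw [integral_const_mul]
  simp only [noisyObs]
  rw [integral_add ((h.memLp_field _).integrable (by norm_num))
    ((h.memLp_noise _).integrable (by norm_num)), h.mean_field, h.mean_noise]
  simp

lemma integral_posteriorResidual (h : IsGaussianRegression P f e k s) (v : Fin N → T) (x : T) :
    P[posteriorResidual f e k s v x] = 0 := by
  have := h.isProbabilityMeasure
  simp only [posteriorResidual]
  rw [integral_sub ((h.memLp_field _).integrable (by norm_num))
    ((h.memLp_posteriorMeanField v x).integrable (by norm_num)), h.mean_field,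
    h.integral_posteriorMeanField, sub_zero]

/-- The coefficients `(1, 0)`, `(1, -1)` and `(-1, 2)` give the field, the residual and the
reflected field. -/
lemma isGaussianProcess_combination (h : IsGaussianRegression P f e k s) (v : Fin N → T)
    (a b : ℝ) :
    IsGaussianProcess (fun x w => a * f x w + b * posteriorMeanField f e k s v x w) P := by
  have := h.gaussian.linearCombination (S := T) fun x =>
    a • Finsupp.single (Sum.inl x) 1 + b • ∑ i, posteriorWeight k s v x i •
      (Finsupp.single (Sum.inl (v i)) 1 + Finsupp.single (Sum.inr i) 1)
  convert this using 3 with x w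
  rw [posteriorMeanField_eq_sum]
  simp [noisyObs, mul_add]

lemma isGaussianProcess_posteriorResidual (h : IsGaussianRegression P f e k s) (v : Fin N → T) :
    IsGaussianProcess (posteriorResidual f e k s v) P := by
  convert h.isGaussianProcess_combination v 1 (-1) using 3 with x w
  simp [posteriorResidual]
  ring

/-- Reflecting the field at its posterior mean does not change its law. -/
lemma map_reflection (h : IsGaussianRegression P f e k s) (hs : 0 < s) (v : Fin N → T) :
    P.map (fun w x => f x w) =
      P.map (fun w x => f x w - 2 * posteriorResidual f e k s v x w) := by
  have key := map_add_eq_map_sub_of_uncorrelated (P := P)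
    (M := posteriorMeanField f e k s v) (R := posteriorResidual f e k s v)
    (h.memLp_posteriorMeanField v) (h.memLp_posteriorResidual v)
    (h.measurable_posteriorMeanField v) (h.measurable_posteriorResidual v)
    (h.integral_posteriorMeanField v) (h.integral_posteriorResidual v)
    (fun x y => by
      rw [covariance_comm, posteriorMeanField_eq_sum, h.cov_posteriorResidual_sum_noisyObs hs])
    (by
      convert h.isGaussianProcess_combination v 1 0 using 3 with x w
      simp [posteriorResidual])
    (by
      convert h.isGaussianProcess_combination v (-1) 2 using 3 with x w
      simp [posteriorResidual]
      ring)
  convert key using 4 with w x w x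
  · simp [posteriorResidual]
  · simp [posteriorResidual]
    ring

/-- Uniform deviation bound for a fixed design, on a countable set `D` with a finite net `F`. -/
lemma measure_exists_posteriorResidual_gt_le [PseudoMetricSpace T]
    (h : IsGaussianRegression P f e k s) (hs : 0 < s) (v : Fin N → T) {D : Set T}
    (hD : D.Countable) {F : Finset T} (hFD : ↑F ⊆ D) {τ Lip t b : ℝ}
    (hF : ∀ x ∈ D, ∃ y ∈ F, dist x y ≤ τ) (hLip : 0 ≤ Lip) (ht : 0 ≤ t) (hLt : Lip * τ ≤ t / 2)
    (hb : ∀ y ∈ F, Var[posteriorResidual f e k s v y; P] ≤ b) :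
    P {w | ∃ x ∈ D, t < |posteriorResidual f e k s v x w|} ≤
      2 * P {w | ¬ ∀ x ∈ D, ∀ y ∈ D, |f x w - f y w| ≤ Lip * dist x y} +
        F.card * ENNReal.ofReal (2 * Real.exp (-(t / 2) ^ 2 / (2 * b))) := by
  set R := posteriorResidual f e k s v with hR
  set g : T → Ω → ℝ := fun x w => f x w - 2 * R x w with hg
  -- Restricting the Lipschitz condition to the countable `D` makes it measurable for the product
  -- σ-algebra, so that its probability depends only on the law of the process.
  set A : Set (T → ℝ) := {φ | ∀ x ∈ D, ∀ y ∈ D, |φ x - φ y| ≤ Lip * dist x y} with hA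
  have hAm : MeasurableSet A := by
    have : A = ⋂ x ∈ D, ⋂ y ∈ D, {φ : T → ℝ | |φ x - φ y| ≤ Lip * dist x y} := by
      ext φ
      simp [hA]
    rw [this]
    refine MeasurableSet.biInter hD fun x _ => MeasurableSet.biInter hD fun y _ => ?_
    exact measurableSet_le (by fun_prop) measurable_const
  have hfm : Measurable fun w x => f x w := measurable_pi_lambda _ h.measurable_field
  have hgm : Measurable fun w x => g x w := measurable_pi_lambda _ fun x =>
    (h.measurable_field x).sub ((h.measurable_posteriorResidual v x).const_mul 2)
  have hlaw : P {w | (fun x => g x w) ∉ A} = P {w | (fun x => f x w) ∉ A} := by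
    have h1 := Measure.map_apply hfm hAm.compl (μ := P)
    have h2 := Measure.map_apply hgm hAm.compl (μ := P)
    rw [h.map_reflection hs v] at h1
    exact h2.symm.trans h1
  have hsub : {w | ∃ x ∈ D, t < |R x w|} ⊆ ({w | (fun x => f x w) ∉ A} ∪
      {w | (fun x => g x w) ∉ A}) ∪ ⋃ y ∈ F, {w | t / 2 ≤ |R y w|} := by
    rintro w ⟨x, hx, hxt⟩
    by_contra hcon
    simp only [Set.mem_union, Set.mem_ofPred_eq, Set.mem_iUnion, not_or, not_not, not_exists,
      not_le, exists_prop, not_and] at hcon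
    obtain ⟨⟨hfA, hgA⟩, hnet⟩ := hcon
    obtain ⟨y, hy, hxy⟩ := hF x hx
    have h1 := hfA x hx y (hFD hy)
    have h2 := hgA x hx y (hFD hy)
    have h3 := hnet y hy
    have h4 : Lip * dist x y ≤ t / 2 := (mul_le_mul_of_nonneg_left hxy hLip).trans hLt
    simp only [hg] at h2
    have h5 : |R x w - R y w| ≤ t / 2 := by
      have : R x w - R y w = ((f x w - f y w) -
        ((f x w - 2 * R x w) - (f y w - 2 * R y w))) / 2 := by ring
      rw [this, abs_div, abs_two]
      have := abs_sub (f x w - f y w) ((f x w - 2 * R x w) - (f y w - 2 * R y w))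
      linarith
    have h6 := abs_sub_abs_le_abs_sub (R x w) (R y w)
    linarith
  refine (measure_mono hsub).trans ((measure_union_le _ _).trans (add_le_add ?_ ?_))
  · refine (measure_union_le _ _).trans (le_of_eq ?_)
    rw [hlaw, ← two_mul]
    rfl
  · refine (measure_biUnion_finset_le _ _).trans ?_
    rw [← nsmul_eq_mul]
    refine Finset.sum_le_card_nsmul _ _ _ fun y hy => ?_
    exact ((h.isGaussianProcess_posteriorResidual v).hasGaussianLaw_eval y).measure_abs_ge_le
      (h.integral_posteriorResidual v y) (hb y hy) (by linarith)

end IsGaussianRegression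
end ReflectionPrinciple

/-! ### From frozen designs to an independent random design. -/

section RandomDesign

open Filter Topology

variable {Ω V H : Type*} [MeasurableSpace Ω] {P : Measure Ω}

/-- A bound for every frozen value of `Z` carries over to the random `Z`, independent of `h`,
provided that the exceptional event is stable under small perturbations of `Z`. No joint
measurability of `E` is needed. -/
lemma measure_le_of_eventually_mem [IsProbabilityMeasure P] [PseudoMetricSpace V]
    [MeasurableSpace V] [BorelSpace V] [SecondCountableTopology V] [Nonempty V]
    [MeasurableSpace H] {Z : Ω → V} {h : Ω → H} (hZ : Measurable Z)
    (hind : IndepFun Z h P) {E : V → Set H} (hE : ∀ v, MeasurableSet (E v))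
    {b : ℝ≥0∞} (hb : ∀ v, P (h ⁻¹' E v) ≤ b) {A : Set Ω}
    (hA : ∀ w ∈ A, ∀ᶠ v in 𝓝 (Z w), h w ∈ E v) : P A ≤ b := by
  -- Finite-valued approximations of `Z`: conditioning on their values is a finite sum, and they
  -- remain functions of `Z`, hence independent of `h`.
  set Zk : ℕ → SimpleFunc Ω V := fun m =>
    (SimpleFunc.nearestPt (TopologicalSpace.denseSeq V) m).comp Z hZ with hZk
  have hindk : ∀ m v (B : Set H), MeasurableSet B →
      P (Zk m ⁻¹' {v} ∩ h ⁻¹' B) = P (Zk m ⁻¹' {v}) * P (h ⁻¹' B) := fun m v B hB =>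
    hind.measure_inter_preimage_eq_mul (SimpleFunc.nearestPt _ m ⁻¹' {v}) _
      (SimpleFunc.measurableSet_fiber _ _) hB
  set B : ℕ → Set Ω := fun m => {w | h w ∈ E (Zk m w)} with hB
  have hBb : ∀ m, P (B m) ≤ b := by
    intro m
    have hsub : B m ⊆ ⋃ v ∈ (Zk m).range, (Zk m ⁻¹' {v} ∩ h ⁻¹' E v) := by
      intro w hw
      simp only [Set.mem_iUnion]
      exact ⟨Zk m w, SimpleFunc.mem_range_self _ _, rfl, hw⟩
    calc P (B m) ≤ ∑ v ∈ (Zk m).range, P (Zk m ⁻¹' {v} ∩ h ⁻¹' E v) :=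
          (measure_mono hsub).trans (measure_biUnion_finset_le _ _)
      _ = ∑ v ∈ (Zk m).range, P (Zk m ⁻¹' {v}) * P (h ⁻¹' E v) :=
          Finset.sum_congr rfl fun v _ => hindk m v _ (hE v)
      _ ≤ ∑ v ∈ (Zk m).range, P (Zk m ⁻¹' {v}) * b :=
          Finset.sum_le_sum fun v _ => by gcongr; exact hb v
      _ = b := by
          rw [← Finset.sum_mul, (Zk m).sum_range_measure_preimage_singleton, measure_univ, one_mul]
  -- By stability, a point of `A` lies in `B m` for all large `m`; the sets over `K` increase and
  -- each has measure at most `b`.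
  have hsub : A ⊆ ⋃ K, ⋂ m, ⋂ (_ : K ≤ m), B m := by
    intro w hw
    have ht : Tendsto (fun m => Zk m w) atTop (𝓝 (Z w)) :=
      SimpleFunc.tendsto_nearestPt
        (by rw [(TopologicalSpace.denseRange_denseSeq V).closure_range]; trivial)
    obtain ⟨K, hK⟩ := eventually_atTop.1 (ht.eventually (hA w hw))
    simp only [Set.mem_iUnion, Set.mem_iInter]
    exact ⟨K, fun m hm => hK m hm⟩
  refine (measure_mono hsub).trans ?_
  rw [Monotone.measure_iUnion]
  · exact iSup_le fun K => (measure_mono (Set.iInter₂_subset K le_rfl)).trans (hBb K)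
  · intro K K' hKK'
    exact Set.iInter_mono fun m => Set.iInter_mono' fun hm => ⟨hKK'.trans hm, le_rfl⟩

/-- If `X` is independent of `(Y, Z)` and `Y` is independent of `Z`, then `Y` is independent of
`(X, Z)`. -/
lemma ProbabilityTheory.IndepFun.rotate [IsProbabilityMeasure P] {α β γ : Type*}
    [MeasurableSpace α] [MeasurableSpace β] [MeasurableSpace γ] {X : Ω → α} {Y : Ω → β}
    {Z : Ω → γ} (hX : Measurable X) (hY : Measurable Y) (hZ : Measurable Z)
    (h1 : IndepFun X (fun w => (Y w, Z w)) P) (h2 : IndepFun Y Z P) :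
    IndepFun Y (fun w => (X w, Z w)) P := by
  have h1' := (indepFun_iff_map_prod_eq_prod_map_map hX.aemeasurable
    (hY.prodMk hZ).aemeasurable).1 h1
  have h2' := (indepFun_iff_map_prod_eq_prod_map_map hY.aemeasurable hZ.aemeasurable).1 h2
  have h3 : IndepFun X Z P := h1.comp measurable_id measurable_snd
  have h3' := (indepFun_iff_map_prod_eq_prod_map_map hX.aemeasurable hZ.aemeasurable).1 h3
  have := Measure.isProbabilityMeasure_map hX.aemeasurable (μ := P)
  have := Measure.isProbabilityMeasure_map hY.aemeasurable (μ := P)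
  have := Measure.isProbabilityMeasure_map hZ.aemeasurable (μ := P)
  rw [indepFun_iff_map_prod_eq_prod_map_map hY.aemeasurable (hX.prodMk hZ).aemeasurable, h3']
  have hp : MeasurePreserving (fun q : α × β × γ => (q.2.1, q.1, q.2.2))
      ((P.map X).prod ((P.map Y).prod (P.map Z))) ((P.map Y).prod ((P.map X).prod (P.map Z))) :=
    ((measurePreserving_prodAssoc _ _ _).comp
      ((Measure.measurePreserving_swap (μ := P.map X) (ν := P.map Y)).prod
        (MeasurePreserving.id (P.map Z)))).comp (measurePreserving_prodAssoc _ _ _).symm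
  rw [← hp.map_eq, ← h2', ← h1', Measure.map_map hp.measurable (hX.prodMk (hY.prodMk hZ))]
  rfl

end RandomDesign

/-! ### Lipschitz bounds, nets and small balls inside a Euclidean ball. -/

section Geometry

variable {n : ℕ}

lemma EuclideanSpace.mem_ball_of_abs_sub_le {o y z : EuclideanSpace ℝ (Fin n)} {ρ : ℝ}
    (hy : y ∈ Metric.ball o ρ) (h : ∀ i, |z i - o i| ≤ |y i - o i|) : z ∈ Metric.ball o ρ := by
  rw [Metric.mem_ball, EuclideanSpace.dist_eq] at hy ⊢
  refine lt_of_le_of_lt (Real.sqrt_le_sqrt (Finset.sum_le_sum fun i _ => ?_)) hy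
  rw [Real.dist_eq, Real.dist_eq]
  exact pow_le_pow_left₀ (abs_nonneg _) (h i) 2

section LineDeriv

variable {g : EuclideanSpace ℝ (Fin n) → ℝ} {o : EuclideanSpace ℝ (Fin n)} {ρ L : ℝ}

lemma abs_sub_le_of_hasLineDerivAt_direction
    (h : ∀ x ∈ Metric.ball o ρ, ∀ i : Fin n, ∃ D : ℝ,
      HasLineDerivAt ℝ g D x (EuclideanSpace.single i 1) ∧ |D| < L)
    {x : EuclideanSpace ℝ (Fin n)} {i : Fin n} {t : ℝ} (hx : x ∈ Metric.ball o ρ)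
    (hxt : x + t • EuclideanSpace.single i (1 : ℝ) ∈ Metric.ball o ρ) :
    |g (x + t • EuclideanSpace.single i (1 : ℝ)) - g x| ≤ L * |t| := by
  set u : EuclideanSpace ℝ (Fin n) := EuclideanSpace.single i 1
  set A : Set ℝ := {r | x + r • u ∈ Metric.ball o ρ} with hA
  have hconv : Convex ℝ A := by
    intro a ha b hb α β hα hβ hαβ
    have := (convex_ball o ρ) ha hb hα hβ hαβ
    simp only [hA, Set.mem_ofPred_eq]
    convert this using 1
    calc x + (α • a + β • b) • u = (α + β) • x + (α • a + β • b) • u := by rw [hαβ, one_smul]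
      _ = _ := by simp only [smul_eq_mul]; module
  have hex : ∀ r : ℝ, ∃ D, r ∈ A → HasLineDerivAt ℝ g D (x + r • u) u ∧ |D| < L := by
    intro r
    by_cases hr : r ∈ A
    · obtain ⟨D, hD⟩ := h _ hr i
      exact ⟨D, fun _ => hD⟩
    · exact ⟨0, fun h' => absurd h' hr⟩
  choose D hD using hex
  have key := hconv.norm_image_sub_le_of_norm_hasDerivWithin_le (f := fun r => g (x + r • u))
    (f' := D) (C := L) (x := 0) (y := t) (fun r hr => ?_) (fun r hr => (hD r hr).2.le)
    (by simpa [hA] using hx) hxt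
  · simpa using key
  · have h1 : HasDerivAt (fun a => g (x + r • u + a • u)) (D r) (r - r) := by
      rw [sub_self]
      exact (hD r hr).1
    have h2 := h1.comp_sub_const r r
    refine (h2.congr_of_eventuallyEq (Filter.Eventually.of_forall fun a => ?_)).hasDerivWithinAt
    simp only
    congr 1
    module

/-- Change the coordinates one at a time. As each moves no farther from the center, the
axis-parallel path stays in the ball, and only partial derivatives are needed. -/
lemma abs_sub_le_of_hasLineDerivAt_of_abs_le
    (h : ∀ x ∈ Metric.ball o ρ, ∀ i : Fin n, ∃ D : ℝ,
      HasLineDerivAt ℝ g D x (EuclideanSpace.single i 1) ∧ |D| < L)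
    {z y : EuclideanSpace ℝ (Fin n)} (hy : y ∈ Metric.ball o ρ)
    (hzy : ∀ i, |z i - o i| ≤ |y i - o i|) :
    |g z - g y| ≤ ∑ i, L * |z i - y i| := by
  set p : Finset (Fin n) → EuclideanSpace ℝ (Fin n) := fun s =>
    WithLp.toLp 2 fun i => if i ∈ s then z i else y i with hp
  have hmem : ∀ s, p s ∈ Metric.ball o ρ := fun s =>
    EuclideanSpace.mem_ball_of_abs_sub_le hy fun i => by
      simp only [hp]
      split_ifs
      exacts [hzy i, le_rfl]
  have key : ∀ s : Finset (Fin n), |g (p s) - g y| ≤ ∑ i ∈ s, L * |z i - y i| := by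
    intro s
    induction s using Finset.induction_on with
    | empty =>
      have : p ∅ = y := by ext i; simp [hp]
      simp [this]
    | insert i s hi ih =>
      have hpi : p (insert i s) = p s + (z i - y i) • EuclideanSpace.single i (1 : ℝ) := by
        ext l
        by_cases hl : l = i
        · subst hl
          simp [hp, hi]
        · simp [hp, hl]
      have h1 := abs_sub_le_of_hasLineDerivAt_direction h (hmem s) (hpi ▸ hmem (insert i s))
      rw [← hpi] at h1
      rw [Finset.sum_insert hi]
      have h2 := abs_sub_le (g (p (insert i s))) (g (p s)) (g y)
      linarith
  have : p Finset.univ = z := by ext i; simp [hp]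
  simpa [this] using key Finset.univ

/-- A function on a Euclidean ball whose partial derivatives are bounded is Lipschitz. -/
lemma abs_sub_le_of_hasLineDerivAt (hL : 0 ≤ L)
    (h : ∀ x ∈ Metric.ball o ρ, ∀ i : Fin n, ∃ D : ℝ,
      HasLineDerivAt ℝ g D x (EuclideanSpace.single i 1) ∧ |D| < L)
    {x y : EuclideanSpace ℝ (Fin n)} (hx : x ∈ Metric.ball o ρ) (hy : y ∈ Metric.ball o ρ) :
    |g x - g y| ≤ n * L * dist x y := by
  -- Taking in each coordinate the value nearer to the center makes both moves, from `x` and from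
  -- `y` to `m`, admissible; in each coordinate only one of the two is nontrivial.
  set m : EuclideanSpace ℝ (Fin n) :=
    WithLp.toLp 2 fun i => if |x i - o i| ≤ |y i - o i| then x i else y i with hm
  have h1 : |g m - g x| ≤ ∑ i, L * |m i - x i| :=
    abs_sub_le_of_hasLineDerivAt_of_abs_le h hx fun i => by
      simp only [hm]
      split_ifs with hi
      exacts [le_rfl, (not_le.1 hi).le]
  have h2 : |g m - g y| ≤ ∑ i, L * |m i - y i| :=
    abs_sub_le_of_hasLineDerivAt_of_abs_le h hy fun i => by
      simp only [hm]
      split_ifs with hi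
      exacts [hi, le_rfl]
  have h3 : ∀ i, L * |m i - x i| + L * |m i - y i| ≤ L * dist x y := fun i => by
    have h4 : |m i - x i| + |m i - y i| ≤ |x i - y i| := by
      simp only [hm]
      split_ifs
      · simp
      · simp [abs_sub_comm]
    have h5 : |x i - y i| ≤ dist x y := by
      rw [dist_eq_norm]
      exact PiLp.norm_apply_le (x - y) i
    rw [← mul_add]
    exact mul_le_mul_of_nonneg_left (h4.trans h5) hL
  have h6 := abs_sub_le (g x) (g m) (g y)
  rw [abs_sub_comm (g x) (g m)] at h6
  calc |g x - g y| ≤ ∑ i, (L * |m i - x i| + L * |m i - y i|) := by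
        rw [Finset.sum_add_distrib]
        linarith
    _ ≤ ∑ _i : Fin n, L * dist x y := Finset.sum_le_sum fun i _ => h3 i
    _ = n * L * dist x y := by simp [mul_assoc]

end LineDeriv

/-- A Euclidean ball has a finite `τ`-net of controlled cardinality inside the ball. -/
lemma EuclideanSpace.exists_finset_net_ball (hn : 0 < n) (o : EuclideanSpace ℝ (Fin n)) {ρ τ : ℝ}
    (hρ : 0 < ρ) (hτ : 0 < τ) :
    ∃ F : Finset (EuclideanSpace ℝ (Fin n)), ↑F ⊆ Metric.ball o ρ ∧
      (∀ x ∈ Metric.ball o ρ, ∃ y ∈ F, dist x y ≤ τ) ∧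
      (F.card : ℝ) ≤ (2 * ρ * √n / τ + 2) ^ n := by
  classical
  have hn' : (0 : ℝ) < √n := Real.sqrt_pos.2 (by exact_mod_cast hn)
  -- Grid cells of side `a` have diameter `τ`.
  set a : ℝ := τ / √n with ha
  have ha0 : 0 < a := div_pos hτ hn'
  set φ : EuclideanSpace ℝ (Fin n) → Fin n → ℤ := fun x i => ⌊(x i - o i) / a⌋ with hφ
  set G : Finset (Fin n → ℤ) := Fintype.piFinset fun _ => Finset.Icc ⌊-(ρ / a)⌋ ⌊ρ / a⌋ with hG
  have hcard : (G.card : ℝ) ≤ (2 * ρ * √n / τ + 2) ^ n := by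
    rw [hG, Fintype.card_piFinset_const, Nat.cast_pow, Int.card_Icc]
    refine pow_le_pow_left₀ (Nat.cast_nonneg _) ?_ n
    have h0 : ⌊-(ρ / a)⌋ ≤ ⌊ρ / a⌋ := Int.floor_le_floor (by
      have := div_pos hρ ha0
      linarith)
    have h1 : (((⌊ρ / a⌋ + 1 - ⌊-(ρ / a)⌋).toNat : ℤ) : ℝ) = ⌊ρ / a⌋ + 1 - ⌊-(ρ / a)⌋ := by
      rw [Int.toNat_of_nonneg (by linarith)]
      push_cast
      ring
    have h2 := Int.floor_le (ρ / a)
    have h3 := Int.lt_floor_add_one (-(ρ / a))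
    have h4 : 2 * ρ * √n / τ = 2 * (ρ / a) := by
      rw [ha]
      field_simp
    rw [h4]
    rw [Int.cast_natCast] at h1
    linarith
  have hmemG : ∀ x ∈ Metric.ball o ρ, φ x ∈ G := fun x hx => by
    rw [hG, Fintype.mem_piFinset]
    intro i
    have h1 : |x i - o i| ≤ ρ := by
      rw [Metric.mem_ball, dist_eq_norm] at hx
      exact (PiLp.norm_apply_le (x - o) i).trans hx.le
    rw [abs_le] at h1
    rw [Finset.mem_Icc]
    refine ⟨Int.floor_le_floor ?_, Int.floor_le_floor ?_⟩
    · rw [← neg_div]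
      gcongr
      exact h1.1
    · gcongr
      exact h1.2
  have hclose : ∀ x y, φ x = φ y → dist x y ≤ τ := fun x y hxy => by
    rw [EuclideanSpace.dist_eq]
    have h1 : ∀ i, dist (x i) (y i) ^ 2 ≤ a ^ 2 := fun i => by
      have h2 := Int.abs_sub_lt_one_of_floor_eq_floor (congrFun hxy i)
      rw [Real.dist_eq]
      refine pow_le_pow_left₀ (abs_nonneg _) ?_ 2
      rw [← sub_div, abs_div, abs_of_pos ha0, div_lt_one ha0, sub_sub_sub_cancel_right] at h2
      exact h2.le
    calc √(∑ i, dist (x i) (y i) ^ 2) ≤ √(∑ _i : Fin n, a ^ 2) :=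
          Real.sqrt_le_sqrt (Finset.sum_le_sum fun i _ => h1 i)
      _ = τ := by
          rw [Finset.sum_const, Finset.card_univ, Fintype.card_fin, nsmul_eq_mul,
            Real.sqrt_mul (Nat.cast_nonneg n), Real.sqrt_sq ha0.le, ha]
          field_simp
  -- Keep the cells that meet the ball and pick a representative there, so that the net lies in the
  -- ball.
  set G' := G.filter fun c => ∃ x ∈ Metric.ball o ρ, φ x = c with hG'
  have hpick : ∀ c : Fin n → ℤ, ∃ x, c ∈ G' → x ∈ Metric.ball o ρ ∧ φ x = c := fun c => by
    by_cases hc : c ∈ G'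
    · obtain ⟨x, hx⟩ := (Finset.mem_filter.1 hc).2
      exact ⟨x, fun _ => hx⟩
    · exact ⟨0, fun h => absurd h hc⟩
  choose r hr using hpick
  refine ⟨G'.image r, ?_, fun x hx => ?_, ?_⟩
  · intro y hy
    simp only [Finset.coe_image, Set.mem_image, Finset.mem_coe] at hy
    obtain ⟨c, hc, rfl⟩ := hy
    exact (hr c hc).1
  · have hc : φ x ∈ G' := Finset.mem_filter.2 ⟨hmemG x hx, x, hx, rfl⟩
    exact ⟨r (φ x), Finset.mem_image_of_mem _ hc, hclose _ _ (hr _ hc).2.symm⟩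
  · refine le_trans ?_ hcard
    exact_mod_cast Finset.card_image_le.trans (Finset.card_filter_le _ _)

/-- Each ball centered in `B(o, ρ)` of radius `r ≤ 2 ρ` shares a ball of radius `r / 2` with
`B(o, ρ)`. -/
lemma exists_ball_subset_inter_ball {o x : EuclideanSpace ℝ (Fin n)} {ρ r : ℝ} (hr : 0 < r)
    (hrρ : r ≤ 2 * ρ) (hx : x ∈ Metric.ball o ρ) :
    ∃ y, Metric.ball y (r / 2) ⊆ Metric.ball x r ∩ Metric.ball o ρ := by
  have hρ : 0 < ρ := by linarith
  have hx' : dist o x ≤ ρ := by rw [dist_comm]; exact (Metric.mem_ball.1 hx).le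
  have ht0 : 0 ≤ r / (2 * ρ) := by positivity
  have ht1 : r / (2 * ρ) ≤ 1 := (div_le_one (by positivity)).2 hrρ
  -- The center is pulled toward `o` by the fraction `r / (2 * ρ)`: a move of at most `r / 2` that
  -- leaves distance at least `r / 2` to the boundary of `B(o, ρ)`.
  refine ⟨AffineMap.lineMap x o (r / (2 * ρ)), Set.subset_inter
    (Metric.ball_subset_ball' ?_) (Metric.ball_subset_ball' ?_)⟩
  · rw [dist_lineMap_left, Real.norm_of_nonneg ht0, dist_comm]
    have : r / (2 * ρ) * dist o x ≤ r / (2 * ρ) * ρ := by gcongr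
    have h2 : r / (2 * ρ) * ρ = r / 2 := by field_simp
    linarith
  · rw [dist_lineMap_right, Real.norm_of_nonneg (by linarith), dist_comm]
    have : (1 - r / (2 * ρ)) * dist o x ≤ (1 - r / (2 * ρ)) * ρ := by
      gcongr
    have h2 : (1 - r / (2 * ρ)) * ρ = ρ - r / 2 := by field_simp
    linarith

end Geometry

/-! ### Counting sample points in a set. -/

section Sampling

variable {Ω E : Type*} [MeasurableSpace Ω] {P : Measure Ω} {N : ℕ} [MeasurableSpace E]

/-- Hoeffding lower tail bound for the number of i.i.d. points falling into a set. -/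
lemma measure_sum_indicator_le [IsProbabilityMeasure P] {z : Fin N → Ω → E}
    (hz : ∀ i, Measurable (z i)) (hind : iIndepFun z P) {A : Set E} (hA : MeasurableSet A) {p : ℝ}
    (hp : 0 ≤ p) (hpA : ∀ i, p ≤ P.real (z i ⁻¹' A)) :
    P {w | ∑ i, A.indicator (1 : E → ℝ) (z i w) ≤ N * p / 2} ≤
      ENNReal.ofReal (Real.exp (-(N * p ^ 2 / 2))) := by
  -- The sign turns the lower tail into an upper one. Values in `[-1, 0]` give variance proxy `1 /
  -- 4`, whence the exponent `2 (N p / 2) ^ 2 / N = N p ^ 2 / 2`.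
  set X : Fin N → Ω → ℝ := fun i w => -A.indicator (1 : E → ℝ) (z i w) with hX
  have hXm : ∀ i, Measurable (X i) := fun i =>
    ((measurable_const.indicator hA).comp (hz i)).neg
  have hmean : ∀ i, P[X i] = -P.real (z i ⁻¹' A) := fun i => by
    simp only [hX]
    rw [integral_neg, ← integral_indicator_one (hz i hA)]
    rfl
  have hsub : ∀ i, HasSubgaussianMGF (fun w => X i w - P[X i]) ((‖(0 : ℝ) - (-1)‖₊ / 2) ^ 2) P :=
    fun i => hasSubgaussianMGF_of_mem_Icc (hXm i).aemeasurable
      (Filter.Eventually.of_forall fun w => by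
        simp only [hX, Set.indicator]
        split_ifs <;> simp)
  have hindX : iIndepFun (fun i w => X i w - P[X i]) P :=
    hind.comp (fun i y => -A.indicator (1 : E → ℝ) y - ∫ w, X i w ∂P) fun i =>
      (measurable_one.indicator hA).neg.sub_const _
  have key := HasSubgaussianMGF.measure_sum_ge_le_of_iIndepFun hindX (s := Finset.univ)
    (fun i _ => hsub i) (ε := N * p / 2) (by positivity)
  rw [← ofReal_measureReal]
  refine ENNReal.ofReal_le_ofReal ((measureReal_mono fun w hw => ?_).trans (key.trans ?_))
  · simp only [Set.mem_ofPred_eq] at hw ⊢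
    rw [Finset.sum_sub_distrib]
    have h1 : ∑ i, P[X i] ≤ -(N * p) := by
      calc ∑ i, P[X i] ≤ ∑ _i : Fin N, -p := Finset.sum_le_sum fun i _ => by
            rw [hmean]
            linarith [hpA i]
        _ = -(N * p) := by simp
    simp only [hX, Finset.sum_neg_distrib] at h1 ⊢
    linarith
  · obtain rfl | hN := Nat.eq_zero_or_pos N
    · simp
    · have : (0 : ℝ) < N := by exact_mod_cast hN
      refine Real.exp_le_exp.2 (le_of_eq ?_)
      simp
      field_simp

end Sampling

/-! ### Continuity in the design and the random-design bound. -/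

section RandomDesignRegression

variable {Ω T : Type*} [MeasurableSpace Ω] {P : Measure Ω} {N : ℕ}

/-- A Gaussian process and an independent Gaussian vector are jointly Gaussian. -/
lemma ProbabilityTheory.IsGaussianProcess.sumElim {f : T → Ω → ℝ} {e : Fin N → Ω → ℝ}
    (hf : IsGaussianProcess f P) (he : HasGaussianLaw (fun w i => e i w) P)
    (hind : IndepFun (fun w x => f x w) (fun w i => e i w) P) :
    IsGaussianProcess (Sum.elim f e) P := by
  refine ⟨fun I => ?_⟩
  set J : Finset T := I.toLeft with hJ
  have h1 : IndepFun (fun w => J.restrict (f · w)) (fun w i => e i w) P :=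
    hind.comp (Finset.measurable_restrict J) measurable_id
  have h2 := h1.hasGaussianLaw (hf.hasGaussianLaw J) he
  let L : ((J → ℝ) × (Fin N → ℝ)) →L[ℝ] (I → ℝ) := ContinuousLinearMap.pi fun u =>
    match u with
    | ⟨Sum.inl x, hx⟩ => (ContinuousLinearMap.proj (⟨x, Finset.mem_toLeft.2 hx⟩ : J)).comp
        (ContinuousLinearMap.fst ℝ _ _)
    | ⟨Sum.inr i, _⟩ => (ContinuousLinearMap.proj i).comp (ContinuousLinearMap.snd ℝ _ _)
  have h3 : (fun w => I.restrict (Sum.elim f e · w)) =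
      L ∘ fun w => (J.restrict (f · w), fun i => e i w) := by
    funext w u
    obtain ⟨u | u, hu⟩ := u <;> rfl
  rw [h3]
  exact h2.map L

namespace IsGaussianRegression

variable {f : T → Ω → ℝ} {e : Fin N → Ω → ℝ} {k : T → T → ℝ} {s : ℝ}

lemma continuous_posteriorWeight [TopologicalSpace T] (h : IsGaussianRegression P f e k s)
    (hs : 0 < s) (hk : Continuous fun q : T × T => k q.1 q.2) :
    Continuous fun q : (Fin N → T) × T => posteriorWeight k s q.1 q.2 := by
  have h1 : Continuous fun q : (Fin N → T) × T => noisyGram k s q.1 := by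
    unfold noisyGram
    refine Continuous.add (continuous_matrix fun i l => ?_) continuous_const
    exact hk.comp (by fun_prop : Continuous fun q : (Fin N → T) × T => (q.1 i, q.1 l))
  have h2 : Continuous fun q : (Fin N → T) × T => (noisyGram k s q.1)⁻¹ := by
    simp only [Matrix.inv_def, Ring.inverse_eq_inv']
    exact (h1.matrix_det.inv₀ fun q => (h.posDef_noisyGram hs q.1).det_pos.ne').smul
      h1.matrix_adjugate
  unfold posteriorWeight
  refine Continuous.matrix_vecMul (continuous_pi fun i => ?_) h2
  exact hk.comp (by fun_prop : Continuous fun q : (Fin N → T) × T => (q.2, q.1 i))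

/-- Passage from fixed designs to a random design that is independent of field and noise. -/
lemma measure_exists_gt_le_of_random_design [MetricSpace T] [SecondCountableTopology T]
    [MeasurableSpace T] [BorelSpace T] (h : IsGaussianRegression P f e k s) (hs : 0 < s)
    (hk : Continuous fun q : T × T => k q.1 q.2) {Z : Ω → Fin N → T} (hZ : Measurable Z)
    (hind : IndepFun Z (fun w => ((fun x => f x w), fun i => e i w)) P)
    {G : Set (Fin N → T)} (hG : IsOpen G) {D : Set T} (hD : D.Countable) (hDd : Dense D)
    {t : ℝ} {b : ℝ≥0∞}
    (hb : ∀ v ∈ G, P {w | ∃ x ∈ D, t < |posteriorResidual f e k s v x w|} ≤ b) :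
    P {w | Z w ∈ G ∧ Continuous (fun x => f x w) ∧
      ∃ x, t < |posteriorResidual f e k s (Z w) x w|} ≤ b := by
  have := h.isProbabilityMeasure
  obtain hV | hV := isEmpty_or_nonempty (Fin N → T)
  · have : IsEmpty Ω := ⟨fun w => hV.elim (Z w)⟩
    rw [Set.eq_empty_of_isEmpty {w | Z w ∈ G ∧ Continuous (fun x => f x w) ∧
      ∃ x, t < |posteriorResidual f e k s (Z w) x w|}]
    simp
  set Φ : (T → ℝ) × (Fin N → ℝ) → (Fin N → T) → T → ℝ := fun q v x =>
    q.1 x - gpPosteriorMean k s v (fun i => q.1 (v i) + q.2 i) x with hΦ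
  refine measure_le_of_eventually_mem hZ hind
    (E := fun v => {q | v ∈ G ∧ ∃ x ∈ D, t < |Φ q v x|}) (fun v => ?_) (fun v => ?_) ?_
  · by_cases hv : v ∈ G
    · have : {q | v ∈ G ∧ ∃ x ∈ D, t < |Φ q v x|} = ⋃ x ∈ D, {q | t < |Φ q v x|} := by
        ext q
        simp [hv]
      rw [this]
      refine MeasurableSet.biUnion hD fun x _ => measurableSet_lt measurable_const ?_
      simp only [hΦ, gpPosteriorMean_eq_sum]
      fun_prop
    · simp [hv]
  · by_cases hv : v ∈ G
    · refine (measure_mono fun w hw => ?_).trans (hb v hv)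
      exact hw.2
    · simp [hv]
  · rintro w ⟨hwG, hwc, x₀, hx₀⟩
    have hc : Continuous fun p : (Fin N → T) × T =>
        Φ ((fun x => f x w), fun i => e i w) p.1 p.2 := by
      simp only [hΦ, gpPosteriorMean_eq_sum]
      refine (hwc.comp continuous_snd).sub (continuous_finsetSum _ fun i _ => ?_)
      refine ((continuous_apply i).comp (h.continuous_posteriorWeight hs hk)).mul ?_
      exact (hwc.comp (by fun_prop : Continuous fun p : (Fin N → T) × T => p.1 i)).add
        continuous_const
    -- Openness is used twice: in `x`, to replace the bad point by one of the dense set `D`, and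
    -- then in the design, with that point fixed.
    have ho : IsOpen {x | t < |Φ ((fun x => f x w), fun i => e i w) (Z w) x|} :=
      isOpen_lt continuous_const
        (hc.comp (by fun_prop : Continuous fun x : T => (Z w, x))).abs
    obtain ⟨x, hx, hxD⟩ := hDd.exists_mem_open ho ⟨x₀, hx₀⟩
    have ho' : IsOpen {v | t < |Φ ((fun x => f x w), fun i => e i w) v x|} :=
      isOpen_lt continuous_const
        (hc.comp (by fun_prop : Continuous fun v : Fin N → T => (v, x))).abs
    filter_upwards [hG.mem_nhds hwG, ho'.mem_nhds (by assumption)] with v hv hv'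
    exact ⟨hv, x, by assumption, hv'⟩

/-- The covariance kernel is continuous if the field is continuous in quadratic mean. -/
lemma continuous_kernel [PseudoMetricSpace T] (h : IsGaussianRegression P f e k s) {C ω : ℝ}
    (hω : 0 < ω) (hk : ∀ x y, k x x + k y y - 2 * k x y ≤ C * dist x y ^ ω) :
    Continuous fun q : T × T => k q.1 q.2 := by
  have := h.isProbabilityMeasure
  -- The kernel is the Gram kernel of the map `F` into `L²`, and the increment bound makes `F`
  -- continuous.
  set F : T → Lp ℝ 2 P := fun x => (h.memLp_field x).toLp (f x) with hF
  have hin : ∀ x y, k x y = inner ℝ (F x) (F y) := fun x y => by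
    rw [← h.cov_field, L2.inner_def, covariance]
    refine integral_congr_ae ?_
    filter_upwards [(h.memLp_field x).coeFn_toLp, (h.memLp_field y).coeFn_toLp] with w hx hy
    simp only [hF]
    rw [hx, hy, h.mean_field, h.mean_field]
    simp [mul_comm]
  have hFc : Continuous F := by
    rw [continuous_iff_continuousAt]
    intro x
    rw [ContinuousAt, tendsto_iff_norm_sub_tendsto_zero]
    have h1 : Filter.Tendsto (fun y => √(C * dist y x ^ ω)) (nhds x) (nhds 0) := by
      have : Continuous fun y => √(C * dist y x ^ ω) := by
        refine Real.continuous_sqrt.comp (continuous_const.mul ?_)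
        exact (continuous_id.dist continuous_const).rpow_const fun _ => Or.inr hω.le
      have h2 := this.tendsto x
      rwa [dist_self, Real.zero_rpow hω.ne', mul_zero, Real.sqrt_zero] at h2
    refine squeeze_zero (fun _ => norm_nonneg _) (fun y => Real.le_sqrt_of_sq_le ?_) h1
    refine le_of_eq_of_le ?_ (hk y x)
    rw [norm_sub_sq_real, ← real_inner_self_eq_norm_sq, ← real_inner_self_eq_norm_sq, ← hin, ← hin,
      ← hin]
    ring
  simp only [hin]
  exact (hFc.comp continuous_fst).inner (hFc.comp continuous_snd)

end IsGaussianRegression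
end RandomDesignRegression

/-! ### The setting of the theorem as a scalar regression in each coordinate. -/

section GPDisturbance

variable {Ω : Type*} [MeasurableSpace Ω] {P : Measure Ω} {n N : ℕ}
  {S : Set (EuclideanSpace ℝ (Fin n))} {κ : Fin n → ℝ → ℝ} {CK ω a₁ a₂ : ℝ}
  {d : EuclideanSpace ℝ (Fin n) → Ω → EuclideanSpace ℝ (Fin n)}
  {o : EuclideanSpace ℝ (Fin n)} {ρ c s : ℝ} {q : EuclideanSpace ℝ (Fin n) → ℝ}
  {z ε : Fin N → Ω → EuclideanSpace ℝ (Fin n)}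

lemma IsNoisySampling.hasLaw_noise_apply (h : IsNoisySampling P S d o ρ c s q z ε)
    (i : Fin N) (j : Fin n) : HasLaw (fun w => ε i w j) (gaussianReal 0 (s ^ 2).toNNReal) P := by
  have hS : (s ^ 2 • (1 : Matrix (Fin n) (Fin n) ℝ)).PosSemidef :=
    Matrix.PosSemidef.one.smul (sq_nonneg s)
  have := (measurePreserving_eval_multivariateGaussian (μ := 0) hS (i := j)).hasLaw.comp
    (h.noise_law i)
  simpa [Function.comp_def] using this

lemma IsNoisySampling.iIndepFun_noise_apply (h : IsNoisySampling P S d o ρ c s q z ε)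
    (j : Fin n) : iIndepFun (fun i w => ε i w j) P :=
  h.noise_indep.comp (fun _ y => y j) fun _ => by fun_prop

lemma isGaussianRegression_coordinate (hd : IsGPDisturbance P S κ CK ω a₁ a₂ d)
    (hB : Metric.ball o ρ ⊆ S) (h : IsNoisySampling P S d o ρ c s q z ε) (j : Fin n) :
    IsGaussianRegression P (fun (x : Metric.ball o ρ) w => d x w j) (fun i w => ε i w j)
      (fun x y => κ j ‖(x : EuclideanSpace ℝ (Fin n)) - y‖) s := by
  have hind : IndepFun (fun w (x : Metric.ball o ρ) => d x w j) (fun w i => ε i w j) P :=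
    h.field_data_indep.comp
      (φ := fun (y : S → EuclideanSpace ℝ (Fin n)) (x : Metric.ball o ρ) => y ⟨x, hB x.2⟩ j)
      (ψ := fun (y : (Fin N → EuclideanSpace ℝ (Fin n)) × (Fin N → EuclideanSpace ℝ (Fin n)))
        (i : Fin N) => y.2 i j) (by fun_prop) (by fun_prop)
  have hG : IsGaussianProcess (fun (x : Metric.ball o ρ) w => d x w j) P :=
    (hd.gaussian.comp_right fun x : Metric.ball o ρ => (⟨x, hB x.2⟩ : S)).comp_left
      fun _ => EuclideanSpace.proj j
  have hε : ∀ i, HasGaussianLaw (fun w => ε i w j) P := fun i =>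
    (h.hasLaw_noise_apply i j).hasGaussianLaw
  exact
  { measurable_field := fun x => by
      have := hd.measurable x (hB x.2)
      fun_prop
    measurable_noise := fun i => by
      have := h.noise_measurable i
      fun_prop
    gaussian := hG.sumElim ((h.iIndepFun_noise_apply j).hasGaussianLaw hε) hind
    mean_field := fun x => hd.mean_zero x (hB x.2) j
    mean_noise := fun i => by
      rw [(h.hasLaw_noise_apply i j).integral_eq, integral_id_gaussianReal]
    cov_field := fun x y => hd.covariance_eq x (hB x.2) y (hB y.2) j
    cov_field_noise := fun x i =>
      (hind.comp (measurable_pi_apply x) (measurable_pi_apply i)).covariance_eq_zero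
        (hG.hasGaussianLaw_eval x).memLp_two (hε i).memLp_two
    cov_noise := fun i l => by
      split_ifs with hil
      · subst hil
        rw [covariance_self (hε i).aemeasurable, (h.hasLaw_noise_apply i j).variance_eq,
          variance_id_gaussianReal, Real.coe_toNNReal _ (sq_nonneg s)]
      · exact ((h.iIndepFun_noise_apply j).indepFun hil).covariance_eq_zero
          (hε i).memLp_two (hε l).memLp_two }

lemma IsGPDisturbance.increment_le (hd : IsGPDisturbance P S κ CK ω a₁ a₂ d) (hCK : 0 ≤ CK)
    (j : Fin n) (x y : EuclideanSpace ℝ (Fin n)) :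
    κ j ‖x - x‖ + κ j ‖y - y‖ - 2 * κ j ‖x - y‖ ≤ CK ^ 2 * dist x y ^ (2 * ω) := by
  rw [sub_self, sub_self, norm_zero, dist_eq_norm]
  obtain h0 | h0 := (norm_nonneg (x - y)).eq_or_lt
  · rw [← h0]
    have : (0 : ℝ) ≤ CK ^ 2 * 0 ^ (2 * ω) := by positivity
    linarith
  · have h1 := hd.kernel_modulus j _ h0
    have h2 := (Real.sqrt_le_left (by positivity)).1 h1
    rw [mul_pow, ← Real.rpow_natCast (‖x - y‖ ^ ω) 2, ← Real.rpow_mul h0.le, mul_comm ω] at h2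
    push_cast at h2
    linarith

lemma IsGPDisturbance.measure_not_lipschitz_le (hd : IsGPDisturbance P S κ CK ω a₁ a₂ d)
    (hB : Metric.ball o ρ ⊆ S) (j : Fin n) {L : ℝ} (hL : 0 < L) :
    P {w | ¬ ∀ x y : Metric.ball o ρ, |d x w j - d y w j| ≤ n * L * dist x y} ≤
      ENNReal.ofReal (a₁ * n * Real.exp (-(L ^ 2 / a₂ ^ 2))) := by
  refine (measure_mono ?_).trans (hd.derivative_tail j L hL)
  refine fun w hw h => hw fun x y => ?_
  exact abs_sub_le_of_hasLineDerivAt (g := fun y => d y w j) hL.le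
    (fun x hx => h x (interior_maximal hB Metric.isOpen_ball hx)) x.2 y.2

/-- Volume of the unit ball. -/
noncomputable def unitBallVolume (n : ℕ) : ℝ :=
  volume.real (Metric.ball (0 : EuclideanSpace ℝ (Fin n)) 1)

lemma unitBallVolume_pos (n : ℕ) : 0 < unitBallVolume n :=
  ENNReal.toReal_pos (Metric.measure_ball_pos _ _ one_pos).ne' measure_ball_lt_top.ne

/-- Lower bound for the probability that a sampled point falls into a ball of radius `r`. -/
lemma IsNoisySampling.le_measureReal_ball [IsProbabilityMeasure P]
    (h : IsNoisySampling P S d o ρ c s q z ε) (hc : 0 ≤ c) {r : ℝ} (hr : 0 < r) (hrρ : r ≤ 2 * ρ)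
    {x : EuclideanSpace ℝ (Fin n)} (hx : x ∈ Metric.ball o ρ) (i : Fin N) :
    c * (unitBallVolume n * (r / 2) ^ n) ≤
      P.real (z i ⁻¹' (Metric.ball x r ∩ Metric.ball o ρ)) := by
  obtain ⟨y, hy⟩ := exists_ball_subset_inter_ball hr hrρ hx
  have hvol : volume (Metric.ball y (r / 2)) =
      ENNReal.ofReal (unitBallVolume n * (r / 2) ^ n) := by
    rw [Measure.addHaar_ball_of_pos _ _ (by positivity), finrank_euclideanSpace_fin, unitBallVolume,
      mul_comm, ENNReal.ofReal_mul (by positivity), ofReal_measureReal]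
  have hm : MeasurableSet (Metric.ball x r ∩ Metric.ball o ρ) :=
    measurableSet_ball.inter measurableSet_ball
  have key : ENNReal.ofReal (c * (unitBallVolume n * (r / 2) ^ n)) ≤
      P (z i ⁻¹' (Metric.ball x r ∩ Metric.ball o ρ)) := by
    rw [← Measure.map_apply (h.points_measurable i) hm, (h.points_law i).map_eq,
      withDensity_apply _ hm, Measure.restrict_restrict hm, Set.inter_assoc, Set.inter_self,
      ENNReal.ofReal_mul hc, ← hvol]
    calc ENNReal.ofReal c * volume (Metric.ball y (r / 2))
        ≤ ENNReal.ofReal c * volume (Metric.ball x r ∩ Metric.ball o ρ) := by gcongr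
      _ = ∫⁻ _ in Metric.ball x r ∩ Metric.ball o ρ, ENNReal.ofReal c := by
          rw [setLIntegral_const]
      _ ≤ ∫⁻ u in Metric.ball x r ∩ Metric.ball o ρ, ENNReal.ofReal (q u) :=
          setLIntegral_mono' hm fun u hu => ENNReal.ofReal_le_ofReal (h.density_lower u hu.2)
  exact (ENNReal.ofReal_le_iff_le_toReal (measure_ne_top _ _)).1 key

lemma IsNoisySampling.ae_mem_ball (h : IsNoisySampling P S d o ρ c s q z ε) (i : Fin N) :
    P {w | z i w ∉ Metric.ball o ρ} = 0 := by
  have h1 := Measure.map_apply (h.points_measurable i) (measurableSet_ball (x := o) (ε := ρ)).compl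
    (μ := P)
  rw [(h.points_law i).map_eq, withDensity_apply _ measurableSet_ball.compl,
    Measure.restrict_restrict measurableSet_ball.compl, Set.compl_inter_self] at h1
  exact h1.symm.trans (by simp)

end GPDisturbance

/-! ### Uniform error bound with free parameters. -/

section UniformBound

variable {Ω : Type*} [MeasurableSpace Ω] {P : Measure Ω} {n N : ℕ}
  {S : Set (EuclideanSpace ℝ (Fin n))} {κ : Fin n → ℝ → ℝ} {CK ω a₁ a₂ : ℝ}
  {d : EuclideanSpace ℝ (Fin n) → Ω → EuclideanSpace ℝ (Fin n)}
  {o : EuclideanSpace ℝ (Fin n)} {ρ c s : ℝ} {q : EuclideanSpace ℝ (Fin n) → ℝ}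
  {z ε : Fin N → Ω → EuclideanSpace ℝ (Fin n)}

lemma Finset.sum_indicator_one_eq_card {ι α : Type*} [Fintype ι] (A : Set α) (v : ι → α)
    [DecidablePred fun i => v i ∈ A] :
    ∑ i, A.indicator (1 : α → ℝ) (v i) = (Finset.univ.filter fun i => v i ∈ A).card := by
  classical
  simp [Set.indicator_apply]

/-- Designs with more than `m` points in the ball of radius `r` around each point of `F` form an
open set. -/
lemma isOpen_setOf_lt_sum_indicator_ball {T : Type*} [PseudoMetricSpace T] (F : Finset T)
    (r m : ℝ) :
    IsOpen {v : Fin N → T | ∀ y ∈ F,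
      m < ∑ i, (Metric.ball y r).indicator (1 : T → ℝ) (v i)} := by
  have : {v : Fin N → T | ∀ y ∈ F, m < ∑ i, (Metric.ball y r).indicator (1 : T → ℝ) (v i)} =
      ⋂ y ∈ F, {v | m < ∑ i, (Metric.ball y r).indicator (1 : T → ℝ) (v i)} := by
    ext v
    simp
  rw [this]
  refine isOpen_biInter_finset fun y _ => ?_
  -- Indicators of open balls are lower semicontinuous, so strict lower bounds on the count are open
  -- conditions.
  have hl : LowerSemicontinuous fun v : Fin N → T =>
      ∑ i, (Metric.ball y r).indicator (1 : T → ℝ) (v i) :=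
    lowerSemicontinuous_sum fun i _ =>
      (Metric.isOpen_ball.lowerSemicontinuous_indicator zero_le_one).comp
        (continuous_apply i)
  exact hl.isOpen_preimage m

/-- For a design with many points near each point of the net `F`, the deviation probability of a
coordinate of the posterior mean is small. -/
lemma measure_coordinate_deviation_le (hd : IsGPDisturbance P S κ CK ω a₁ a₂ d) (hCK : 0 ≤ CK)
    (hω : 0 < ω) (hB : Metric.ball o ρ ⊆ S) (h : IsNoisySampling P S d o ρ c s q z ε) (hs : 0 < s)
    {L r t τ m b : ℝ} (hL : 0 < L) (ht : 0 ≤ t) (hm : 0 < m)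
    (hLt : n * L * τ ≤ t / 2) (hvar : CK ^ 2 * r ^ (2 * ω) + s ^ 2 / m ≤ b)
    {F : Finset (Metric.ball o ρ)} (hF : ∀ x : Metric.ball o ρ, ∃ y ∈ F, dist x y ≤ τ)
    {D : Set (Metric.ball o ρ)} (hD : D.Countable) (hFD : ↑F ⊆ D) (j : Fin n)
    {v : Fin N → Metric.ball o ρ}
    (hv : ∀ y ∈ F, m < ∑ i, (Metric.ball y r).indicator (1 : Metric.ball o ρ → ℝ) (v i)) :
    P {w | ∃ x ∈ D, t < |IsGaussianRegression.posteriorResidual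
        (fun (x : Metric.ball o ρ) w => d x w j) (fun i w => ε i w j)
        (fun x y => κ j ‖(x : EuclideanSpace ℝ (Fin n)) - y‖) s v x w|} ≤
      2 * ENNReal.ofReal (a₁ * n * Real.exp (-(L ^ 2 / a₂ ^ 2))) +
        F.card * ENNReal.ofReal (2 * Real.exp (-(t / 2) ^ 2 / (2 * b))) := by
  classical
  have hreg := isGaussianRegression_coordinate hd hB h j
  refine (hreg.measure_exists_posteriorResidual_gt_le (b := b) hs v hD hFD
    (fun x _ => hF x) (by positivity) ht hLt fun y hy => ?_).trans ?_
  · set I : Finset (Fin N) := Finset.univ.filter fun i => v i ∈ Metric.ball y r with hI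
    have hcard := hv y hy
    rw [Finset.sum_indicator_one_eq_card, ← hI] at hcard
    have hI0 : I.Nonempty := by
      rw [← Finset.card_pos]
      exact_mod_cast hm.trans hcard
    refine (hreg.variance_posteriorResidual_le_of_close hs v y hI0
      (b := CK ^ 2 * r ^ (2 * ω)) fun i hi => ?_).trans (le_trans ?_ hvar)
    · refine (hd.increment_le hCK j y (v i)).trans ?_
      have : dist (y : EuclideanSpace ℝ (Fin n)) (v i) ≤ r := by
        rw [dist_comm]
        exact (Metric.mem_ball.1 (Finset.mem_filter.1 hi).2).le
      gcongr
    · gcongr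
  · gcongr
    refine (measure_mono ?_).trans (hd.measure_not_lipschitz_le hB j hL)
    exact fun w hw hcon => hw fun x _ y _ => hcon x y

/-- Uniform error bound for the posterior mean in terms of a mesh `τ`, a radius `r`, a Lipschitz
level `L` and a bound `b` for the posterior variance. -/
theorem measure_uniform_error_le [IsProbabilityMeasure P]
    (hd : IsGPDisturbance P S κ CK ω a₁ a₂ d) (hCK : 0 ≤ CK)
    (hω : 0 < ω) (hB : Metric.ball o ρ ⊆ S) (h : IsNoisySampling P S d o ρ c s q z ε) (hs : 0 < s)
    (hc : 0 < c) (hρ : 0 < ρ) (hN : 0 < N)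
    {L r t τ p b : ℝ} (hL : 0 < L) (hr : 0 < r) (hrρ : r ≤ 2 * ρ) (ht : 0 ≤ t)
    (hLt : n * L * τ ≤ t / 2) (hp : p = c * (unitBallVolume n * (r / 2) ^ n))
    (hvar : CK ^ 2 * r ^ (2 * ω) + s ^ 2 / (N * p / 2) ≤ b)
    {F : Finset (EuclideanSpace ℝ (Fin n))} (hFB : ↑F ⊆ Metric.ball o ρ)
    (hF : ∀ x ∈ Metric.ball o ρ, ∃ y ∈ F, dist x y ≤ τ) :
    P {w | ¬ ∀ x ∈ Metric.ball o ρ,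
        ‖d x w - vectorPosteriorMean κ s (fun i => z i w) (fun i => d (z i w) w + ε i w) x‖
          ≤ √n * t} ≤
      n * (3 * ENNReal.ofReal (a₁ * n * Real.exp (-(L ^ 2 / a₂ ^ 2))) +
        F.card * ENNReal.ofReal (2 * Real.exp (-(t / 2) ^ 2 / (2 * b)))) +
      F.card * ENNReal.ofReal (Real.exp (-(N * p ^ 2 / 2))) := by
  classical
  have hN' : (0 : ℝ) < N := by exact_mod_cast hN
  have hp0 : 0 < p := by
    have := unitBallVolume_pos n
    rw [hp]
    positivity
  have hoB : o ∈ Metric.ball o ρ := Metric.mem_ball_self hρ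
  -- Makes the sample points take values in the ball everywhere; they change only on a null event.
  set φ : EuclideanSpace ℝ (Fin n) → Metric.ball o ρ := fun x =>
    if hx : x ∈ Metric.ball o ρ then ⟨x, hx⟩ else ⟨o, hoB⟩ with hφ
  have hφm : Measurable φ := by
    refine Measurable.dite (s := Metric.ball o ρ) measurable_id measurable_const
      measurableSet_ball
  set Z : Ω → Fin N → Metric.ball o ρ := fun w i => φ (z i w) with hZ
  have hZm : Measurable Z := measurable_pi_lambda _ fun i => hφm.comp (h.points_measurable i)
  set F' : Finset (Metric.ball o ρ) := F.subtype (· ∈ Metric.ball o ρ) with hF'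
  have hF'card : F'.card ≤ F.card := by
    rw [hF', Finset.card_subtype]
    exact Finset.card_filter_le _ _
  have hF'net : ∀ x : Metric.ball o ρ, ∃ y ∈ F', dist x y ≤ τ := fun x => by
    obtain ⟨y, hy, hxy⟩ := hF x x.2
    exact ⟨⟨y, hFB hy⟩, by simpa [hF'] using hy, hxy⟩
  obtain ⟨D₀, hD₀c, hD₀d⟩ := TopologicalSpace.exists_countable_dense (Metric.ball o ρ)
  set D : Set (Metric.ball o ρ) := D₀ ∪ F' with hD
  have hDc : D.Countable := hD₀c.union F'.countable_toSet
  have hDd : Dense D := hD₀d.mono Set.subset_union_left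
  set G : Set (Fin N → Metric.ball o ρ) := {v | ∀ y ∈ F',
    N * p / 2 < ∑ i, (Metric.ball y r).indicator (1 : Metric.ball o ρ → ℝ) (v i)} with hG
  set R : Fin n → (Fin N → Metric.ball o ρ) → Metric.ball o ρ → Ω → ℝ := fun j =>
    IsGaussianRegression.posteriorResidual
      (fun (x : Metric.ball o ρ) w => d x w j) (fun i w => ε i w j)
      (fun x y => κ j ‖(x : EuclideanSpace ℝ (Fin n)) - y‖) s with hR
  set lip : Fin n → Set Ω := fun j =>
    {w | ¬ ∀ x y : Metric.ball o ρ, |d x w j - d y w j| ≤ n * L * dist x y} with hlip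
  set A : Fin n → Set Ω := fun j => {w | Z w ∈ G ∧
    Continuous (fun x : Metric.ball o ρ => d x w j) ∧ ∃ x, t < |R j (Z w) x w|} with hA
  set sparse : EuclideanSpace ℝ (Fin n) → Set Ω := fun y => {w | ∑ i,
    (Metric.ball y r ∩ Metric.ball o ρ).indicator (1 : EuclideanSpace ℝ (Fin n) → ℝ) (z i w) ≤
      N * p / 2} with hsparse
  have hlip_le : ∀ j, P (lip j) ≤ ENNReal.ofReal (a₁ * n * Real.exp (-(L ^ 2 / a₂ ^ 2))) :=
    fun j => hd.measure_not_lipschitz_le hB j hL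
  have hsparse_le : ∀ y ∈ F, P (sparse y) ≤ ENNReal.ofReal (Real.exp (-(N * p ^ 2 / 2))) :=
    fun y hy => measure_sum_indicator_le h.points_measurable h.points_indep
      (measurableSet_ball.inter measurableSet_ball) hp0.le fun i =>
        hp ▸ h.le_measureReal_ball hc.le hr hrρ (hFB hy) i
  have hA_le : ∀ j, P (A j) ≤ 2 * ENNReal.ofReal (a₁ * n * Real.exp (-(L ^ 2 / a₂ ^ 2))) +
      F.card * ENNReal.ofReal (2 * Real.exp (-(t / 2) ^ 2 / (2 * b))) := by
    intro j
    have hreg := isGaussianRegression_coordinate hd hB h j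
    have hdm : Measurable fun w (x : S) => d x w :=
      measurable_pi_lambda _ fun x => hd.measurable x x.2
    have hind : IndepFun Z (fun w => ((fun x : Metric.ball o ρ => d x w j), fun i => ε i w j)) P :=
      (IndepFun.rotate hdm (measurable_pi_lambda _ h.points_measurable)
        (measurable_pi_lambda _ h.noise_measurable) h.field_data_indep h.points_noise_indep).comp
        (φ := fun (u : Fin N → EuclideanSpace ℝ (Fin n)) i => φ (u i))
        (ψ := fun (y : (S → EuclideanSpace ℝ (Fin n)) × (Fin N → EuclideanSpace ℝ (Fin n))) =>
          ((fun x : Metric.ball o ρ => y.1 ⟨x, hB x.2⟩ j), fun i => y.2 i j))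
        (by fun_prop) (by fun_prop)
    refine (hreg.measure_exists_gt_le_of_random_design hs
      (hreg.continuous_kernel (C := CK ^ 2) (ω := 2 * ω) (by positivity)
        fun x y => hd.increment_le hCK j x y) hZm hind
      (isOpen_setOf_lt_sum_indicator_ball F' r _) hDc hDd fun v hv =>
      measure_coordinate_deviation_le hd hCK hω hB h hs hL ht (by positivity) hLt hvar hF'net
        hDc Set.subset_union_right j hv).trans ?_
    gcongr
  -- The Lipschitz event enters once more here, to make the paths continuous; with the two uses in
  -- the reflection argument this explains the factor `3`.
  have hsub : {w | ¬ ∀ x ∈ Metric.ball o ρ,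
      ‖d x w - vectorPosteriorMean κ s (fun i => z i w) (fun i => d (z i w) w + ε i w) x‖
        ≤ √n * t} ⊆
      ((⋃ j ∈ (Finset.univ : Finset (Fin n)), (lip j ∪ A j)) ∪
        ⋃ y ∈ F, sparse y) ∪ ⋃ i, {w | z i w ∉ Metric.ball o ρ} := by
    intro w hw
    by_contra hcon
    simp only [Set.mem_union, Set.mem_iUnion, not_or, not_exists, Finset.mem_univ, exists_prop,
      true_and, not_and] at hcon
    obtain ⟨⟨hjw, hyw⟩, hzw⟩ := hcon
    have hzmem : ∀ i, z i w ∈ Metric.ball o ρ := fun i => not_not.1 (hzw i)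
    have hzZ : ∀ i, z i w = (Z w i : EuclideanSpace ℝ (Fin n)) := fun i => by
      simp only [hZ, hφ]
      rw [dif_pos (hzmem i)]
    have hZG : Z w ∈ G := fun y hy => by
      have hyF : (y : EuclideanSpace ℝ (Fin n)) ∈ F := by simpa [hF'] using hy
      refine lt_of_lt_of_eq (not_le.1 (hyw y hyF)) (Finset.sum_congr rfl fun i _ => ?_)
      have : z i w ∈ Metric.ball (y : EuclideanSpace ℝ (Fin n)) r ∩ Metric.ball o ρ ↔
          Z w i ∈ Metric.ball y r := by
        rw [Set.mem_inter_iff, and_iff_left (hzmem i), hzZ i]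
        rfl
      simp only [Set.indicator_apply, this, Pi.one_apply]
    have hres : ∀ j x, |R j (Z w) x w| ≤ t := fun j x => by
      by_contra hx
      refine (hjw j).2 ⟨hZG, ?_, x, not_le.1 hx⟩
      have hl := not_not.1 (hjw j).1
      refine (LipschitzWith.of_dist_le_mul (K := ⟨n * L, by positivity⟩) fun x y => ?_).continuous
      rw [Real.dist_eq]
      exact hl x y
    refine hw fun x hx => ?_
    rw [EuclideanSpace.norm_eq]
    have hcoord : ∀ j, ‖(d x w - vectorPosteriorMean κ s (fun i => z i w)
        (fun i => d (z i w) w + ε i w) x) j‖ ^ 2 ≤ t ^ 2 := fun j => by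
      refine pow_le_pow_left₀ (norm_nonneg _) ?_ 2
      refine le_of_eq_of_le ?_ (hres j ⟨x, hx⟩)
      simp only [hzZ]
      rfl
    calc √(∑ j, ‖(d x w - vectorPosteriorMean κ s (fun i => z i w)
          (fun i => d (z i w) w + ε i w) x) j‖ ^ 2) ≤ √(∑ _j : Fin n, t ^ 2) :=
          Real.sqrt_le_sqrt (Finset.sum_le_sum fun j _ => hcoord j)
      _ = √n * t := by
          rw [Finset.sum_const, Finset.card_univ, Fintype.card_fin, nsmul_eq_mul,
            Real.sqrt_mul (Nat.cast_nonneg n), Real.sqrt_sq ht]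
  have hz0 : P (⋃ i, {w | z i w ∉ Metric.ball o ρ}) = 0 :=
    measure_iUnion_null fun i => h.ae_mem_ball i
  refine (measure_mono hsub).trans ((measure_union_le _ _).trans ?_)
  rw [hz0, add_zero]
  refine (measure_union_le _ _).trans (add_le_add ?_ ?_)
  · refine (measure_biUnion_finset_le _ _).trans ?_
    refine (Finset.sum_le_card_nsmul _ _ (3 * ENNReal.ofReal (a₁ * n *
      Real.exp (-(L ^ 2 / a₂ ^ 2))) + F.card * ENNReal.ofReal
        (2 * Real.exp (-(t / 2) ^ 2 / (2 * b)))) fun j _ => ?_).trans (le_of_eq ?_)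
    · refine (measure_union_le _ _).trans ((add_le_add (hlip_le j) (hA_le j)).trans (le_of_eq ?_))
      ring
    · rw [Finset.card_univ, Fintype.card_fin, nsmul_eq_mul]
  · refine (measure_biUnion_finset_le _ _).trans ?_
    rw [← nsmul_eq_mul]
    exact Finset.sum_le_card_nsmul _ _ _ hsparse_le

end UniformBound

/-! ### Estimates for the choice of parameters. -/

section Numerics

/-- The covering number of the ball at the relevant mesh is at most exponential in the logarithmic
factor `Λ`. -/
lemma net_cardinality_le_exp {n : ℕ} {ρ a₂ c₁ ψ Λ : ℝ} (hn : 0 < n) (hρ : 0 < ρ) (ha₂ : 0 < a₂)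
    (hc₁ : 0 < c₁) (hψ : 0 < ψ) (hΛ1 : 1 ≤ Λ) (hΛψ : Real.log (1 + 1 / ψ) ≤ Λ) :
    (2 * ρ * √n / (ψ / √n / (2 * (n * (a₂ * √(c₁ * Λ))))) + 2) ^ n ≤
      Real.exp (n * (Real.log (2 + 4 * ρ * n ^ 2 * a₂ * √c₁) + 2) * Λ) := by
  have hn' : (0 : ℝ) < n := by exact_mod_cast hn
  have hsn : (0 : ℝ) < √n := Real.sqrt_pos.2 hn'
  have hΛ0 : 0 < Λ := by linarith
  set b : ℝ := 4 * ρ * n ^ 2 * a₂ * √c₁ with hb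
  have hb0 : 0 ≤ b := by positivity
  have h1 : 2 * ρ * √n / (ψ / √n / (2 * (n * (a₂ * √(c₁ * Λ))))) = b * √Λ / ψ := by
    rw [hb, Real.sqrt_mul hc₁.le]
    have h2 : (√n : ℝ) ^ 2 = n := Real.sq_sqrt hn'.le
    have h3 : √c₁ ≠ 0 := (Real.sqrt_pos.2 hc₁).ne'
    have h4 : √Λ ≠ 0 := (Real.sqrt_pos.2 hΛ0).ne'
    field_simp
    rw [h2]
    ring
  have h2 : √Λ ≤ Λ := Real.sqrt_le_iff.2 ⟨hΛ0.le, by nlinarith⟩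
  have h3 : b * √Λ / ψ + 2 ≤ (2 + b) * Λ * (1 + 1 / ψ) := by
    have h4 : b * √Λ / ψ ≤ b * Λ / ψ := by gcongr
    have h5 : (2 + b) * Λ * (1 + 1 / ψ) = b * Λ / ψ + 2 * Λ + b * Λ + 2 * Λ / ψ := by
      field_simp
      ring
    have : 0 ≤ b * Λ := by positivity
    have : 0 ≤ 2 * Λ / ψ := by positivity
    linarith
  have h6 : (2 + b) * Λ * (1 + 1 / ψ) ≤ Real.exp ((Real.log (2 + b) + 2) * Λ) := by
    have h7 : (2 + b) * Λ * (1 + 1 / ψ) =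
        Real.exp (Real.log (2 + b) + Real.log Λ + Real.log (1 + 1 / ψ)) := by
      rw [Real.exp_add, Real.exp_add, Real.exp_log (by positivity), Real.exp_log hΛ0,
        Real.exp_log (by positivity)]
    rw [h7]
    refine Real.exp_le_exp.2 ?_
    have h8 : 0 ≤ Real.log (2 + b) := Real.log_nonneg (by linarith)
    have h9 := Real.log_le_sub_one_of_pos hΛ0
    nlinarith
  rw [h1]
  calc (b * √Λ / ψ + 2) ^ n ≤ Real.exp ((Real.log (2 + b) + 2) * Λ) ^ n := by
        gcongr
        exact h3.trans h6
    _ = _ := by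
        rw [← Real.exp_nat_mul]
        congr 1
        ring

/-- The failure probabilities add up to at most `δ`. -/
lemma sum_failure_probabilities_le {n : ℕ} {a₁ c₂ δ Λ B M : ℝ} (hn : 0 < n) (ha₁ : 0 < a₁)
    (hδ : 0 < δ) (hΛ1 : 1 ≤ Λ) (hΛδ : Real.log (1 / δ) ≤ Λ) (hM0 : 0 ≤ M)
    (hM : M ≤ Real.exp (c₂ * Λ)) (hB : (c₂ + Real.log (6 * n) + 1) * Λ ≤ B) :
    n * (3 * (a₁ * n * Real.exp (-((1 + Real.log (1 + 9 * a₁ * n ^ 2)) * Λ))) +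
      M * (2 * Real.exp (-((c₂ + Real.log (6 * n) + 1) * Λ)))) + M * Real.exp (-B) ≤ δ := by
  have hn' : (1 : ℝ) ≤ n := by exact_mod_cast hn
  have hexp : Real.exp (-Real.log (1 / δ)) = δ := by
    rw [one_div, Real.log_inv, neg_neg, Real.exp_log hδ]
  have h1 : Real.exp (-((1 + Real.log (1 + 9 * a₁ * n ^ 2)) * Λ)) ≤
      δ / (1 + 9 * a₁ * n ^ 2) := by
    have h2 : 0 ≤ Real.log (1 + 9 * a₁ * n ^ 2) := Real.log_nonneg (by
      have : 0 ≤ 9 * a₁ * n ^ 2 := by positivity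
      linarith)
    have h3 : δ / (1 + 9 * a₁ * n ^ 2) =
        Real.exp (-Real.log (1 / δ) - Real.log (1 + 9 * a₁ * n ^ 2)) := by
      rw [Real.exp_sub, hexp, Real.exp_log (by positivity)]
    rw [h3]
    refine Real.exp_le_exp.2 ?_
    nlinarith
  -- Budget: `δ / 3` for the derivative tails, `δ / 3` for the deviations on the net, `δ / 6` for
  -- sparsely sampled balls.
  have h4 : n * (3 * (a₁ * n * Real.exp (-((1 + Real.log (1 + 9 * a₁ * n ^ 2)) * Λ)))) ≤
      δ / 3 := by
    calc n * (3 * (a₁ * n * Real.exp (-((1 + Real.log (1 + 9 * a₁ * n ^ 2)) * Λ))))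
        ≤ n * (3 * (a₁ * n * (δ / (1 + 9 * a₁ * n ^ 2)))) := by gcongr
      _ = 3 * a₁ * n ^ 2 * δ / (1 + 9 * a₁ * n ^ 2) := by ring
      _ ≤ δ / 3 := by
          rw [div_le_div_iff₀ (by positivity) (by norm_num)]
          nlinarith
  have h5 : M * Real.exp (-((c₂ + Real.log (6 * n) + 1) * Λ)) ≤ δ / (6 * n) := by
    have h6 : 0 ≤ Real.log (6 * n) := Real.log_nonneg (by linarith)
    have h7 : δ / (6 * n) = Real.exp (-Real.log (1 / δ) - Real.log (6 * n)) := by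
      rw [Real.exp_sub, hexp, Real.exp_log (by positivity)]
    calc M * Real.exp (-((c₂ + Real.log (6 * n) + 1) * Λ))
        ≤ Real.exp (c₂ * Λ) * Real.exp (-((c₂ + Real.log (6 * n) + 1) * Λ)) := by gcongr
      _ ≤ δ / (6 * n) := by
          rw [← Real.exp_add, h7]
          refine Real.exp_le_exp.2 ?_
          nlinarith
  have h8 : M * Real.exp (-B) ≤ δ / (6 * n) := by
    refine le_trans ?_ h5
    gcongr
  have h9 : δ / (6 * n) ≤ δ / 6 := by
    gcongr
    linarith
  have h10 : n * (2 * (δ / (6 * n))) = δ / 3 := by field_simp; norm_num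
  have h11 : n * (2 * (M * Real.exp (-((c₂ + Real.log (6 * n) + 1) * Λ)))) ≤ δ / 3 := by
    rw [← h10]
    gcongr
  have h12 : (n : ℝ) * (3 * (a₁ * n * Real.exp (-((1 + Real.log (1 + 9 * a₁ * n ^ 2)) * Λ))) +
      M * (2 * Real.exp (-((c₂ + Real.log (6 * n) + 1) * Λ)))) =
      n * (3 * (a₁ * n * Real.exp (-((1 + Real.log (1 + 9 * a₁ * n ^ 2)) * Λ)))) +
      n * (2 * (M * Real.exp (-((c₂ + Real.log (6 * n) + 1) * Λ)))) := by ring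
  rw [h12]
  linarith

/-- Powers of the radius `(ψ / (K √Λ)) ^ (1 / ω)`. -/
lemma radius_pow_eq {n : ℕ} {ω ψ K Λ : ℝ} (hψ : 0 < ψ) (hK : 0 < K)
    (hΛ : 0 < Λ) :
    ((ψ / (K * √Λ)) ^ (1 / ω) / 2) ^ n =
      (1 / 2) ^ n * K ^ (-(n / ω)) * (ψ ^ (n / ω) * Λ ^ (-(n / (2 * ω)))) := by
  have hsΛ : 0 < √Λ := Real.sqrt_pos.2 hΛ
  rw [div_eq_mul_one_div _ (2 : ℝ), mul_pow, ← Real.rpow_natCast ((ψ / (K * √Λ)) ^ (1 / ω)) n,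
    ← Real.rpow_mul (by positivity), Real.div_rpow hψ.le (by positivity),
    Real.mul_rpow hK.le hsΛ.le, Real.sqrt_eq_rpow, ← Real.rpow_mul hΛ.le, Real.rpow_neg hK.le,
    Real.rpow_neg hΛ.le]
  rw [show 1 / ω * (n : ℝ) = n / ω by ring, show 1 / 2 * ((n : ℝ) / ω) = n / (2 * ω) by
    rw [div_mul_div_comm, one_mul]]
  field_simp

/-- The power of `Λ` in the sample size must pay for the factor `Λ ^ (-a)` lost through the
shrinking radius and still leave one `Λ` for the exponent. -/
lemma rpow_neg_mul_pow_ge {Λ a : ℝ} {p : ℕ} (hΛ1 : 1 ≤ Λ) (ha : a + 1 ≤ p) :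
    Λ ≤ Λ ^ p * Λ ^ (-a) := by
  rw [← Real.rpow_natCast, ← Real.rpow_add (by linarith)]
  calc Λ = Λ ^ (1 : ℝ) := (Real.rpow_one Λ).symm
    _ ≤ _ := Real.rpow_le_rpow_of_exponent_le hΛ1 (by linarith)

/-- The sample size makes each small ball contain enough points with high probability. -/
lemma sample_size_mul_sq_ge {n p : ℕ} {ω ψ c c₃ v C Λ N : ℝ} (hω : 0 < ω) (hψ : 0 < ψ)
    (hc : 0 < c) (hv : 0 < v) (hc₃ : 0 < c₃) (hΛ1 : 1 ≤ Λ) (hp : n / ω + 1 ≤ p)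
    (hC : 2 * c₃ / v ^ 2 ≤ C)
    (hN : C * Λ ^ p * (ψ ^ (-(2 * n / ω)) / c ^ 2) ≤ N) :
    c₃ * Λ ≤ N * (c * (v * (ψ ^ (n / ω) * Λ ^ (-(n / (2 * ω)))))) ^ 2 / 2 := by
  have hΛ0 : 0 < Λ := by linarith
  have h1 : (c * (v * (ψ ^ (n / ω) * Λ ^ (-(n / (2 * ω)))))) ^ 2 =
      c ^ 2 * v ^ 2 * (ψ ^ (2 * n / ω) * Λ ^ (-(n / ω))) := by
    have h2 : (ψ ^ (n / ω)) ^ 2 = ψ ^ (2 * n / ω) := by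
      rw [← Real.rpow_natCast, ← Real.rpow_mul hψ.le]
      congr 1
      push_cast
      ring
    have h3 : (Λ ^ (-(n / (2 * ω)))) ^ 2 = Λ ^ (-(n / ω)) := by
      rw [← Real.rpow_natCast, ← Real.rpow_mul hΛ0.le]
      congr 1
      push_cast
      field_simp
    rw [← h2, ← h3]
    ring
  have h4 := rpow_neg_mul_pow_ge hΛ1 hp
  have h5 : ψ ^ (-(2 * n / ω)) * ψ ^ (2 * n / ω) = 1 := by
    rw [← Real.rpow_add hψ]
    simp
  have hX : 0 < c ^ 2 * v ^ 2 * (ψ ^ (2 * n / ω) * Λ ^ (-(n / ω))) := by positivity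
  rw [h1]
  calc c₃ * Λ ≤ c₃ * (Λ ^ p * Λ ^ (-(n / ω))) := by gcongr
    _ = (2 * c₃ / v ^ 2) * Λ ^ p * (ψ ^ (-(2 * n / ω)) / c ^ 2) *
        (c ^ 2 * v ^ 2 * (ψ ^ (2 * n / ω) * Λ ^ (-(n / ω)))) / 2 := by
        have : (2 * c₃ / v ^ 2) * Λ ^ p * (ψ ^ (-(2 * n / ω)) / c ^ 2) *
            (c ^ 2 * v ^ 2 * (ψ ^ (2 * n / ω) * Λ ^ (-(n / ω)))) / 2 =
            (ψ ^ (-(2 * n / ω)) * ψ ^ (2 * n / ω)) * (c₃ * (Λ ^ p * Λ ^ (-(n / ω)))) := by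
          field_simp
        rw [this, h5, one_mul]
    _ ≤ C * Λ ^ p * (ψ ^ (-(2 * n / ω)) / c ^ 2) *
        (c ^ 2 * v ^ 2 * (ψ ^ (2 * n / ω) * Λ ^ (-(n / ω)))) / 2 := by gcongr
    _ ≤ _ := by gcongr

/-- The sample size averages out the noise. -/
lemma sample_size_mul_ge {n p : ℕ} {ω ψ c c₃ v C Λ N s : ℝ} (hω : 0 < ω) (hψ : 0 < ψ)
    (hc : 0 < c) (hv : 0 < v) (hc₃ : 0 < c₃) (hΛ1 : 1 ≤ Λ) (hp : n / ω + 1 ≤ p)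
    (hC : 32 * n * c₃ / v ≤ C)
    (hN : C * Λ ^ p * (s ^ 2 * ψ ^ (-((2 * ω + n) / ω)) / c) ≤ N) :
    32 * n * c₃ * Λ * s ^ 2 / ψ ^ 2 ≤
      N * (c * (v * (ψ ^ (n / ω) * Λ ^ (-(n / (2 * ω)))))) := by
  have hΛ0 : 0 < Λ := by linarith
  have hp' : n / (2 * ω) + 1 ≤ (p : ℝ) := by
    have h0 : 0 ≤ n / ω := by positivity
    have : n / (2 * ω) = (n / ω) / 2 := by field_simp
    rw [this]
    linarith
  have h4 := rpow_neg_mul_pow_ge hΛ1 hp'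
  have h5 : ψ ^ (-((2 * ω + n) / ω)) * ψ ^ (n / ω) = (ψ ^ 2)⁻¹ := by
    rw [← Real.rpow_add hψ, ← Real.rpow_natCast, ← Real.rpow_neg hψ.le]
    congr 1
    push_cast
    field_simp
    ring
  have hX : 0 < c * (v * (ψ ^ (n / ω) * Λ ^ (-(n / (2 * ω))))) := by positivity
  calc 32 * n * c₃ * Λ * s ^ 2 / ψ ^ 2
      ≤ 32 * n * c₃ * (Λ ^ p * Λ ^ (-(n / (2 * ω)))) * s ^ 2 / ψ ^ 2 := by gcongr
    _ = (32 * n * c₃ / v) * Λ ^ p * (s ^ 2 * ψ ^ (-((2 * ω + n) / ω)) / c) *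
        (c * (v * (ψ ^ (n / ω) * Λ ^ (-(n / (2 * ω)))))) := by
        have : (32 * n * c₃ / v) * Λ ^ p * (s ^ 2 * ψ ^ (-((2 * ω + n) / ω)) / c) *
            (c * (v * (ψ ^ (n / ω) * Λ ^ (-(n / (2 * ω)))))) =
            (ψ ^ (-((2 * ω + n) / ω)) * ψ ^ (n / ω)) *
              (32 * n * c₃ * (Λ ^ p * Λ ^ (-(n / (2 * ω)))) * s ^ 2) := by
          field_simp
        rw [this, h5]
        ring
    _ ≤ C * Λ ^ p * (s ^ 2 * ψ ^ (-((2 * ω + n) / ω)) / c) *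
        (c * (v * (ψ ^ (n / ω) * Λ ^ (-(n / (2 * ω)))))) := by gcongr
    _ ≤ _ := by gcongr

end Numerics

/-! ### Choice of constants and conclusion. -/

/-- The sum of the failure probabilities, moved from the extended nonnegative reals to the reals. -/
lemma failure_sum_eq_ofReal (n M : ℕ) {x y u : ℝ} (hx : 0 ≤ x) (hy : 0 ≤ y) (hu : 0 ≤ u) :
    (n : ℝ≥0∞) * (3 * ENNReal.ofReal x + M * ENNReal.ofReal (2 * y)) + M * ENNReal.ofReal u =
      ENNReal.ofReal (n * (3 * x + M * (2 * y)) + M * u) := by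
  have hM : (0 : ℝ) ≤ M := M.cast_nonneg
  rw [ENNReal.ofReal_add (by positivity) (by positivity), ENNReal.ofReal_mul n.cast_nonneg,
    ENNReal.ofReal_add (by positivity) (by positivity), ENNReal.ofReal_mul (p := 3) (by positivity),
    ENNReal.ofReal_mul (p := (M : ℝ)) hM, ENNReal.ofReal_mul (p := (M : ℝ)) hM,
    ENNReal.ofReal_natCast, ENNReal.ofReal_natCast, ENNReal.ofReal_ofNat]

theorem mainTheorem1 (n : ℕ) (ω : ℝ) (hω : 0 < ω) (hω1 : ω ≤ 1) :
    ∃ p : ℕ, ∀ CK a₁ a₂ ρ ψmax : ℝ, 0 < CK → 0 < a₁ → 0 < a₂ → 0 < ρ → 0 < ψmax →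
    ∃ C : ℝ, 0 < C ∧
      ∀ (Ω : Type*) [MeasurableSpace Ω] (P : Measure Ω) [IsProbabilityMeasure P]
        (S : Set (EuclideanSpace ℝ (Fin n))) (κ : Fin n → ℝ → ℝ)
        (d : EuclideanSpace ℝ (Fin n) → Ω → EuclideanSpace ℝ (Fin n))
        (o : EuclideanSpace ℝ (Fin n)) (c s ψ δ : ℝ) (N : ℕ)
        (q : EuclideanSpace ℝ (Fin n) → ℝ)
        (z ε : Fin N → Ω → EuclideanSpace ℝ (Fin n)),
        IsGPDisturbance P S κ CK ω a₁ a₂ d →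
        Metric.ball o ρ ⊆ S →
        0 < c → 0 < s → 0 < ψ → ψ ≤ ψmax → 0 < δ → δ < 1 →
        IsNoisySampling P S d o ρ c s q z ε →
        C * (1 + Real.log (1 / δ) + Real.log (1 + 1 / ψ)) ^ p *
            max (2 * √(n : ℝ) / ψ)
              (max (ψ ^ (-(2 * n / ω)) / c ^ 2)
                (s ^ 2 * ψ ^ (-((2 * ω + n) / ω)) / c)) ≤ (N : ℝ) →
        P {w | ¬ ∀ x ∈ Metric.ball o ρ,
            ‖d x w - vectorPosteriorMean κ s (fun i => z i w) (fun i => d (z i w) w + ε i w) x‖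
              ≤ ψ} ≤ ENNReal.ofReal δ := by
  obtain rfl | hn := Nat.eq_zero_or_pos n
  · refine ⟨0, fun CK a₁ a₂ ρ ψmax _ _ _ _ _ => ⟨1, one_pos, ?_⟩⟩
    intro Ω _ P _ S κ d o c s ψ δ N q z ε _ _ _ _ hψ _ _ _ _ _
    simp [Subsingleton.elim _ (0 : EuclideanSpace ℝ (Fin 0)), hψ.le]
  have hn' : (1 : ℝ) ≤ n := by exact_mod_cast hn
  -- The squared hitting probability carries `Λ ^ (-(n / ω))`, and Hoeffding's exponent must still
  -- be of order `Λ`.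
  refine ⟨⌈(n : ℝ) / ω⌉₊ + 1, fun CK a₁ a₂ ρ ψmax hCK ha₁ ha₂ hρ hψmax => ?_⟩
  set p : ℕ := ⌈(n : ℝ) / ω⌉₊ + 1 with hp
  have hp' : (n : ℝ) / ω + 1 ≤ p := by
    rw [hp]
    push_cast
    linarith [Nat.le_ceil ((n : ℝ) / ω)]
  set c₁ : ℝ := 1 + Real.log (1 + 9 * a₁ * n ^ 2) with hc₁
  have hc₁0 : 0 < c₁ := by
    have : 0 ≤ Real.log (1 + 9 * a₁ * n ^ 2) := Real.log_nonneg (by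
      have : 0 ≤ 9 * a₁ * (n : ℝ) ^ 2 := by positivity
      linarith)
    linarith
  set c₂ : ℝ := n * (Real.log (2 + 4 * ρ * n ^ 2 * a₂ * √c₁) + 2) with hc₂
  have hc₂0 : 0 < c₂ := by
    have : 0 ≤ Real.log (2 + 4 * ρ * n ^ 2 * a₂ * √c₁) := Real.log_nonneg (by
      have : 0 ≤ 4 * ρ * n ^ 2 * a₂ * √c₁ := by positivity
      linarith)
    positivity
  -- `exp (c₂ * Λ)` bounds the size of the net, so the rate `c₃` survives the union bounds over net
  -- points and coordinates.
  set c₃ : ℝ := c₂ + Real.log (6 * n) + 1 with hc₃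
  have hc₃0 : 0 < c₃ := by
    have : 0 ≤ Real.log (6 * n) := Real.log_nonneg (by linarith)
    linarith
  -- The first summand bounds the kernel part of the variance by `b / 2`, the second forces `r ≤ ρ`
  -- for all `ψ ≤ ψmax`.
  set K : ℝ := 4 * √(n * c₃) * CK + ψmax / ρ ^ ω with hK
  have hρω : 0 < ρ ^ ω := Real.rpow_pos_of_pos hρ ω
  have hK0 : 0 < K := by positivity
  have hK1 : 16 * n * c₃ * CK ^ 2 ≤ K ^ 2 := by
    have h1 : (4 * √(n * c₃) * CK) ^ 2 = 16 * n * c₃ * CK ^ 2 := by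
      rw [mul_pow, mul_pow, Real.sq_sqrt (by positivity)]
      ring
    rw [← h1]
    have : 0 ≤ ψmax / ρ ^ ω := by positivity
    exact pow_le_pow_left₀ (by positivity) (by linarith) 2
  have hK2 : ψmax ≤ K * ρ ^ ω := by
    rw [← div_le_iff₀ hρω, hK]
    have : 0 ≤ 4 * √(n * c₃) * CK := by positivity
    linarith
  set v : ℝ := unitBallVolume n * ((1 / 2) ^ n * K ^ (-(n / ω))) with hv
  have hv0 : 0 < v := by
    have := unitBallVolume_pos n
    positivity
  refine ⟨max (2 * c₃ / v ^ 2) (32 * n * c₃ / v), lt_max_of_lt_left (by positivity), ?_⟩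
  set C : ℝ := max (2 * c₃ / v ^ 2) (32 * n * c₃ / v) with hC
  have hC0 : 0 < C := lt_max_of_lt_left (by positivity)
  intro Ω _ P _ S κ d o c s ψ δ N q z ε hd hB hc hs hψ hψψ hδ hδ1 h hN
  set Λ : ℝ := 1 + Real.log (1 / δ) + Real.log (1 + 1 / ψ) with hΛ
  have hlogδ : 0 ≤ Real.log (1 / δ) := Real.log_nonneg ((one_le_div hδ).2 hδ1.le)
  have hlogψ : 0 ≤ Real.log (1 + 1 / ψ) := Real.log_nonneg (by
    have : 0 < 1 / ψ := by positivity
    linarith)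
  have hΛ1 : 1 ≤ Λ := by linarith
  have hΛ0 : 0 < Λ := by linarith
  have hsΛ : 1 ≤ √Λ := Real.one_le_sqrt.2 hΛ1
  have hfac : 0 < C * Λ ^ p := by positivity
  have hN1 : C * Λ ^ p * (ψ ^ (-(2 * n / ω)) / c ^ 2) ≤ N := by
    refine le_trans ?_ hN
    gcongr
    exact (le_max_left _ _).trans (le_max_right _ _)
  have hN2 : C * Λ ^ p * (s ^ 2 * ψ ^ (-((2 * ω + n) / ω)) / c) ≤ N := by
    refine le_trans ?_ hN
    gcongr
    exact (le_max_right _ _).trans (le_max_right _ _)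
  have hNpos : 0 < N := by
    have : (0 : ℝ) < N := lt_of_lt_of_le (by positivity) hN1
    exact_mod_cast this
  have hsn : 0 < √(n : ℝ) := Real.sqrt_pos.2 (by linarith)
  set r : ℝ := (ψ / (K * √Λ)) ^ (1 / ω) with hr
  have hr0 : 0 < r := by positivity
  have hrρ : r ≤ ρ := by
    have h1 : ψ / (K * √Λ) ≤ ρ ^ ω := by
      rw [div_le_iff₀ (by positivity)]
      calc ψ ≤ K * ρ ^ ω := hψψ.trans hK2
        _ ≤ K * ρ ^ ω * √Λ := le_mul_of_one_le_right (by positivity) hsΛ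
        _ = ρ ^ ω * (K * √Λ) := by ring
    calc r ≤ (ρ ^ ω) ^ (1 / ω) := Real.rpow_le_rpow (by positivity) h1 (by positivity)
      _ = ρ := by rw [← Real.rpow_mul hρ.le, mul_one_div_cancel hω.ne', Real.rpow_one]
  have hr2 : r ^ (2 * ω) = ψ ^ 2 / (K ^ 2 * Λ) := by
    rw [hr, ← Real.rpow_mul (by positivity), show 1 / ω * (2 * ω) = ((2 : ℕ) : ℝ) by
      push_cast
      field_simp, Real.rpow_natCast, div_pow, mul_pow, Real.sq_sqrt hΛ0.le]
  set p₀ : ℝ := c * (unitBallVolume n * (r / 2) ^ n) with hp₀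
  have hp₀' : p₀ = c * (v * (ψ ^ (n / ω) * Λ ^ (-(n / (2 * ω))))) := by
    rw [hp₀, hr, radius_pow_eq hψ hK0 hΛ0, hv]
    ring
  have hp₀0 : 0 < p₀ := by
    rw [hp₀']
    positivity
  set L : ℝ := a₂ * √(c₁ * Λ) with hL
  have hL0 : 0 < L := by positivity
  have hL2 : L ^ 2 / a₂ ^ 2 = c₁ * Λ := by
    rw [hL, mul_pow, Real.sq_sqrt (by positivity)]
    field_simp
  set t : ℝ := ψ / √n with ht
  have ht0 : 0 < t := by positivity
  set τ : ℝ := t / (2 * (n * L)) with hτ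
  have hτ0 : 0 < τ := by positivity
  -- Chosen so that the Gaussian exponent `(t / 2) ^ 2 / (2 * b)` equals `c₃ * Λ`; kernel increments
  -- and noise each get half of `b`.
  set b : ℝ := ψ ^ 2 / (8 * n * c₃ * Λ) with hb
  have hN' : (0 : ℝ) < N := by exact_mod_cast hNpos
  have hvar : CK ^ 2 * r ^ (2 * ω) + s ^ 2 / (N * p₀ / 2) ≤ b := by
    have h1 : CK ^ 2 * r ^ (2 * ω) ≤ ψ ^ 2 / (16 * n * c₃ * Λ) := by
      rw [hr2, ← mul_div_assoc, div_le_div_iff₀ (by positivity) (by positivity)]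
      calc CK ^ 2 * ψ ^ 2 * (16 * n * c₃ * Λ) = 16 * n * c₃ * CK ^ 2 * (ψ ^ 2 * Λ) := by ring
        _ ≤ K ^ 2 * (ψ ^ 2 * Λ) := by gcongr
        _ = ψ ^ 2 * (K ^ 2 * Λ) := by ring
    have h2 : s ^ 2 / (N * p₀ / 2) ≤ ψ ^ 2 / (16 * n * c₃ * Λ) := by
      have h3 := sample_size_mul_ge hω hψ hc hv0 hc₃0 hΛ1 hp' (le_max_right _ _) hN2
      rw [← hp₀', div_le_iff₀ (by positivity)] at h3
      rw [div_le_div_iff₀ (by positivity) (by positivity)]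
      linarith
    have h4 : b = ψ ^ 2 / (16 * n * c₃ * Λ) + ψ ^ 2 / (16 * n * c₃ * Λ) := by
      rw [hb]
      field_simp
      norm_num
    linarith
  obtain ⟨F, hFB, hF, hFcard⟩ := EuclideanSpace.exists_finset_net_ball hn o hρ hτ0
  have hFcard' : (F.card : ℝ) ≤ Real.exp (c₂ * Λ) :=
    hFcard.trans (net_cardinality_le_exp hn hρ ha₂ hc₁0 hψ hΛ1 (by linarith))
  have key := measure_uniform_error_le hd hCK.le hω hB h hs hc hρ hNpos hL0 hr0 (by linarith)
    ht0.le (by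
      rw [hτ]
      refine le_of_eq ?_
      field_simp) hp₀ hvar hFB hF
  have hnt : √(n : ℝ) * t = ψ := by
    rw [ht]
    field_simp
  rw [hnt] at key
  refine key.trans ?_
  have htail : -(t / 2) ^ 2 / (2 * b) = -(c₃ * Λ) := by
    have h1 : √(n : ℝ) ^ 2 = n := Real.sq_sqrt (by linarith)
    rw [ht, hb, neg_div, neg_inj, div_pow, div_pow, h1]
    field_simp
    norm_num
  have hreal := sum_failure_probabilities_le hn ha₁ hδ hΛ1 (by linarith) (Nat.cast_nonneg F.card)
    hFcard' (B := N * p₀ ^ 2 / 2) (by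
      rw [hp₀']
      exact sample_size_mul_sq_ge hω hψ hc hv0 hc₃0 hΛ1 hp' (le_max_left _ _) hN1)
  rw [htail, hL2]
  exact le_of_eq_of_le (failure_sum_eq_ofReal n F.card (by positivity) (Real.exp_pos _).le
    (Real.exp_pos _).le) (ENNReal.ofReal_le_ofReal hreal)
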